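/- Let $A\in\mathbb R^{m\times n}$ have rank $m$, let $b\in\mathbb R^m\setminus\{0\}$ and let $t\ge 0$. Put $$V(p)=\tfrac t2\|p\|_2^2+\langle p,b\rangle+\chi(-A^\top p),\qquad p\in\mathbb R^m,$$ where $\chi(s)=0$ if $\|s\|_\infty\le 1$ and $\chi(s)=+\infty$ otherwise. Let $\partial V$ be its subdifferential, and let $\operatorname{dom}\partial V$ be the set of $p$ with $\partial V(p)\ne\varnothing$. The primal problem is to minimise $\|x\|_1+\frac1{2t}\|Ax-b\|_2^2$ over $x\in\mathbb R^n$ if $t>0$ (BPDN), and to minimise $\|x\|_1$ subject to $Ax=b$ if $t=0$ (BP). A dual solution is a minimiser of $V$. Let $\operatorname{sgn}(x)=1$ for $x\ge0$ and $\operatorname{sgn}(x)=-1$ for $x<0$. For $p\in\operatorname{dom}\partial V$ put $\mathcal E(p)=\{j:|(A^\top p)_j|=1\}$ and $D(p)=\mathrm{diag}(\operatorname{sgn}(-A^\top p))$. Let $d(p)=-\mathrm{proj}_{\partial V(p)}(0)$, with $\mathrm{proj}$ the Euclidean projection. For $d\in\mathbb R^m$ put $$\Delta(p,d)=\min_{1\le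 j\le n}\frac{\operatorname{sgn}\big((D(p)A^\top d)_j\big)-(D(p)A^\top p)_j}{(D(p)A^\top d)_j}\in\mathbb R\cup\{+\infty\},$$ where a quotient with zero denominator counts as $+\infty$, and put $\Delta_*(p)=\Delta(p,d(p))$. Let $\tau_*(p)=\Delta_*(p)$ if $t=0$, $\tau_*(p)=-\ln(1-t\Delta_*(p))/t$ if $t>0$ and $t\Delta_*(p)<1$, and $\tau_*(p)=+\infty$ otherwise. Let $f(\tau)=\tau$ if $t=0$ and $f(\tau)=(1-e^{-t\tau})/t$ if $t>0$. Let $\mathrm{NNLS}(p)$ be the set of minimisers of $\|AD(p)u-(b+tp)\|_2^2$ over the $u\in\mathbb R^n$ with $u_j\ge 0$ for $j\in\mathcal E(p)$ and $u_j=0$ for $j\notin\mathcal E(p)$. Let $p^{(0)}\in\operatorname{dom}\partial V$ and $\tau^{(0)}=0$. For $k\ge0$ put $d^{(k)}=d(p^{(k)})$, $\Delta^{(k)}=\Delta_*(p^{(k)})$, $\tau^{(k+1)}=\tau^{(k)}+\tau_*(p^{(k)})$, and let $p^{(k+1)}=p^{(k)}+\min(\Delta^{(k)},1/t)\,d^{(k)}$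 if $t>0$, $p^{(k+1)}=p^{(k)}+\Delta^{(k)}d^{(k)}$ if $t=0$ and $\Delta^{(k)}<+\infty$, and $p^{(k+1)}=p^{(k)}$ otherwise. A slow solution is a function $p:[0,\infty)\to\operatorname{dom}\partial V$ that is absolutely continuous on bounded intervals, has $p(0)=p^{(0)}$, and satisfies $\frac{dp}{d\tau}(\tau)=-\mathrm{proj}_{\partial V(p(\tau))}(0)$ at $\tau=0$ (right derivative) and for almost every $\tau>0$. Then there is exactly one slow solution $p$. For every $k\ge0$ it satisfies $p(\tau)=p^{(k)}+f(\tau-\tau^{(k)})\,d^{(k)}$ on $[\tau^{(k)},\tau^{(k+1)})$. There is an integer $K\ge0$ with the following properties. 1. $d^{(K)}=0$, and $d^{(k)}\neq0$ for all $k<K$. 2. $p(\tau)=p^{(K)}$ for all real $\tau\ge\tau^{(K)}$ (no condition if $\tau^{(K)}=+\infty$, which can happen only if $t>0$), and $\lim_{\tau\to\infty}p(\tau)=p^{(K)}$. 3. $p^{(K)}$ is a dual solution, and it is the only one if $t>0$. 4. $\mathrm{NNLS}(p^{(K)})\ne\varnothing$, and for every $\hat u\in\mathrm{NNLS}(p^{(K)})$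 the vector $D(p^{(K)})\hat u$ is a primal solution. 5. (Correctness of Algorithm 1.) Start the following iteration at $P=p^{(0)}$. At the iterate $P$, choose any $\hat u\in\mathrm{NNLS}(P)$, and let $d=AD(P)\hat u-b-tP$ and $\Delta=\Delta(P,d)$. If $t>0$ and $t\Delta\ge1$, stop and return $x=D(P)\hat u$ and $p^s=P+d/t$. If $t=0$ and $d=0$, stop and return $x=D(P)\hat u$ and $p^s=P$. Otherwise replace $P$ by $P+\Delta d$. Then the iteration can be carried out, and whatever the choices of $\hat u$, it stops after finitely many steps and returns a primal solution $x$ and the dual solution $p^s=p^{(K)}$. -/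

import Mathlib

open Set Filter Topology MeasureTheory
open scoped Matrix

noncomputable section

namespace BPDN

/-- Euclidean space of dimension `k`. -/
abbrev Euc (k : ℕ) : Type := EuclideanSpace ℝ (Fin k)

section Convex

variable {E : Type*} [NormedAddCommGroup E] [InnerProductSpace ℝ E]

/-- The subdifferential at `x` of an extended-real-valued function. -/
def subdifferential (f : E → EReal) (x : E) : Set E :=
  {s | f x < ⊤ ∧ ∀ y, f x + ((inner ℝ s (y - x) : ℝ) : EReal) ≤ f y}

/-- The set `dom ∂f` of points at which `f` has at least one subgradient. -/
def subdiffDomain (f : E → EReal) : Set E :=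
  {x | (subdifferential f x).Nonempty}

open Classical in
/-- Euclidean projection of `x` onto `C`: the point of `C` nearest to `x`.
The value `0` is returned when there is no nearest point; this does not occur for a nonempty,
complete, convex `C`, by `proj_spec`. -/
def proj (C : Set E) (x : E) : E :=
  if h : ∃ y ∈ C, ∀ z ∈ C, ‖x - y‖ ≤ ‖x - z‖ then h.choose else 0

theorem proj_spec {C : Set E} (hne : C.Nonempty) (hc : IsComplete C) (hconv : Convex ℝ C) (x : E) :
    proj C x ∈ C ∧ ∀ z ∈ C, ‖x - proj C x‖ ≤ ‖x - z‖ := by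
  have h : ∃ y ∈ C, ∀ z ∈ C, ‖x - y‖ ≤ ‖x - z‖ := by
    obtain ⟨y, hy, hmin⟩ := exists_norm_eq_iInf_of_complete_convex hne hc hconv x
    refine ⟨y, hy, fun z hz => ?_⟩
    rw [hmin]
    exact ciInf_le ⟨0, by rintro _ ⟨w, rfl⟩; positivity⟩ (⟨z, hz⟩ : C)
  unfold proj
  rw [dif_pos h]
  exact h.choose_spec

end Convex

/-- The sign function with values in `{-1, 1}`, with the convention `sgn 0 = 1`. -/
def sgn (x : ℝ) : ℝ := if 0 ≤ x then 1 else -1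

variable {m n : ℕ}

/-- The vector `A x`, as an element of Euclidean space. -/
def applyMat (A : Matrix (Fin m) (Fin n) ℝ) (x : Fin n → ℝ) : Euc m :=
  WithLp.toLp 2 (A *ᵥ x)

/-- The vector `Aᵀ p`. -/
def applyTr (A : Matrix (Fin m) (Fin n) ℝ) (p : Euc m) : Fin n → ℝ :=
  Aᵀ *ᵥ p.ofLp

/-- The `ℓ¹` norm. -/
def normOne (x : Fin n → ℝ) : ℝ := ∑ j, |x j|

open Classical in
/-- The characteristic function (in the sense of convex analysis) of the unit `ℓ^∞` ball. -/
def charBall (s : Fin n → ℝ) : EReal := if ∀ j, |s j| ≤ 1 then 0 else ⊤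

/-- The dual objective
`V(p; t, b) = (t / 2) ‖p‖² + ⟨p, b⟩ + χ(-Aᵀ p)`, `χ` being the characteristic function of the
unit `ℓ^∞` ball. -/
def potential (A : Matrix (Fin m) (Fin n) ℝ) (b : Euc m) (t : ℝ) (p : Euc m) : EReal :=
  ((t / 2 * ‖p‖ ^ 2 + inner ℝ p b : ℝ) : EReal) + charBall (-applyTr A p)

/-- `p` solves the dual problem: it minimises `V(·; t, b)`. -/
def IsDualSolution (A : Matrix (Fin m) (Fin n) ℝ) (b : Euc m) (t : ℝ) (p : Euc m) : Prop :=
  ∀ q, potential A b t p ≤ potential A b t q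

/-- `x` solves the primal problem: for `t ≠ 0`, it minimises `‖x‖₁ + ‖A x - b‖² / (2 t)`
(basis pursuit denoising); for `t = 0`, it minimises `‖x‖₁` subject to `A x = b`
(basis pursuit). -/
def IsPrimalSolution (A : Matrix (Fin m) (Fin n) ℝ) (b : Euc m) (t : ℝ) (x : Fin n → ℝ) : Prop :=
  if t = 0 then
    applyMat A x = b ∧ ∀ y, applyMat A y = b → normOne x ≤ normOne y
  else
    ∀ y, normOne x + 1 / (2 * t) * ‖applyMat A x - b‖ ^ 2 ≤
      normOne y + 1 / (2 * t) * ‖applyMat A y - b‖ ^ 2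

/-- The equicorrelation set `{j : |(-Aᵀ p)_j| = 1}`. -/
def equicorrelation (A : Matrix (Fin m) (Fin n) ℝ) (p : Euc m) : Set (Fin n) :=
  {j | |(-applyTr A p) j| = 1}

/-- The diagonal matrix of signs `D(p) = diag(sgn(-Aᵀ p))`. -/
def signMat (A : Matrix (Fin m) (Fin n) ℝ) (p : Euc m) : Matrix (Fin n) (Fin n) ℝ :=
  Matrix.diagonal fun j => sgn ((-applyTr A p) j)

/-- The constraints of the nonnegative least-squares problem at `p`: `u ≥ 0` on the
equicorrelation set and `u = 0` off it. -/
def nnlsFeasible (A : Matrix (Fin m) (Fin n) ℝ) (p : Euc m) : Set (Fin n → ℝ) :=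
  {u | (∀ j ∈ equicorrelation A p, 0 ≤ u j) ∧ ∀ j ∉ equicorrelation A p, u j = 0}

/-- The vector `A D(p) u - b - t p`. -/
def nnlsResidual (A : Matrix (Fin m) (Fin n) ℝ) (b : Euc m) (t : ℝ) (p : Euc m)
    (u : Fin n → ℝ) : Euc m :=
  applyMat A (signMat A p *ᵥ u) - b - t • p

/-- The solutions of the nonnegative least-squares problem at `p`: the minimisers of
`‖A D(p) u - (b + t p)‖²` over the feasible vectors. -/
def nnlsSolutions (A : Matrix (Fin m) (Fin n) ℝ) (b : Euc m) (t : ℝ) (p : Euc m) :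
    Set (Fin n → ℝ) :=
  {u | u ∈ nnlsFeasible A p ∧
    ∀ v ∈ nnlsFeasible A p, ‖nnlsResidual A b t p u‖ ^ 2 ≤ ‖nnlsResidual A b t p v‖ ^ 2}

/-- The direction `d(p; t, b) = -proj_{∂V(p; t, b)}(0)`. -/
def direction (A : Matrix (Fin m) (Fin n) ℝ) (b : Euc m) (t : ℝ) (p : Euc m) : Euc m :=
  -proj (subdifferential (potential A b t) p) 0

open Classical in
/-- The maximal descent time from `p` along `d`: the minimum over `j` of
`(sgn (D(p) Aᵀ d)_j - (D(p) Aᵀ p)_j) / (D(p) Aᵀ d)_j`, where a quotient with zero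
denominator counts as `+∞`. -/
def maxDescentTime (A : Matrix (Fin m) (Fin n) ℝ) (p d : Euc m) : EReal :=
  ⨅ j : Fin n,
    if (signMat A p *ᵥ applyTr A d) j = 0 then ⊤
    else (((sgn ((signMat A p *ᵥ applyTr A d) j) - (signMat A p *ᵥ applyTr A p) j) /
      (signMat A p *ᵥ applyTr A d) j : ℝ) : EReal)

/-- `Δ_*(p; t, b)`, the maximal descent time along `d(p; t, b)`. -/
def stepLength (A : Matrix (Fin m) (Fin n) ℝ) (b : Euc m) (t : ℝ) (p : Euc m) : EReal :=
  maxDescentTime A p (direction A b t p)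

open Classical in
/-- `τ_*(p; t, b)`: equal to `Δ_*` if `t = 0`, to `-ln(1 - t Δ_*) / t` if `t ≠ 0` and
`t Δ_* < 1`, and to `+∞` otherwise. -/
def pieceDuration (A : Matrix (Fin m) (Fin n) ℝ) (b : Euc m) (t : ℝ) (p : Euc m) : EReal :=
  if t = 0 then stepLength A b t p
  else if (t : EReal) * stepLength A b t p < 1 then
    ((-Real.log (1 - t * (stepLength A b t p).toReal) / t : ℝ) : EReal)
  else ⊤

open Classical in
/-- The profile `f(τ, t)`: `τ` if `t = 0` and `(1 - e^{-tτ}) / t` otherwise. -/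
def profile (τ t : ℝ) : ℝ := if t = 0 then τ else (1 - Real.exp (-(t * τ))) / t

open Classical in
/-- The breakpoints `p⁽ᵏ⁾` of the slow solution started at `p₀`. -/
def breakPoint (A : Matrix (Fin m) (Fin n) ℝ) (b : Euc m) (t : ℝ) (p₀ : Euc m) : ℕ → Euc m
  | 0 => p₀
  | k + 1 =>
    breakPoint A b t p₀ k +
      if 0 < t then
        (min (stepLength A b t (breakPoint A b t p₀ k)) ((1 / t : ℝ) : EReal)).toReal •
          direction A b t (breakPoint A b t p₀ k)
      else if stepLength A b t (breakPoint A b t p₀ k) < ⊤ then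
        (stepLength A b t (breakPoint A b t p₀ k)).toReal •
          direction A b t (breakPoint A b t p₀ k)
      else 0

/-- The times `τ⁽ᵏ⁾`, possibly `+∞`: `τ⁽⁰⁾ = 0` and `τ⁽ᵏ⁺¹⁾ = τ⁽ᵏ⁾ + τ_*(p⁽ᵏ⁾; t, b)`. -/
def breakTime (A : Matrix (Fin m) (Fin n) ℝ) (b : Euc m) (t : ℝ) (p₀ : Euc m) : ℕ → EReal
  | 0 => 0
  | k + 1 => breakTime A b t p₀ k + pieceDuration A b t (breakPoint A b t p₀ k)

/-- `p : [0, ∞) → dom ∂V` is a solution of the slow system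
`dp/dτ = -proj_{∂V(p(τ))}(0)`, `p(0) = p₀`: it is absolutely continuous on bounded intervals and
satisfies the equation at `τ = 0` (with a right derivative) and for almost every `τ > 0`. -/
structure IsSlowSolution (A : Matrix (Fin m) (Fin n) ℝ) (b : Euc m) (t : ℝ) (p₀ : Euc m)
    (p : ℝ → Euc m) : Prop where
  init : p 0 = p₀
  mem_domain : ∀ τ, 0 ≤ τ → p τ ∈ subdiffDomain (potential A b t)
  absolutelyContinuous : ∀ T, 0 ≤ T → AbsolutelyContinuousOnInterval p 0 T
  deriv_zero : HasDerivWithinAt p (direction A b t (p 0)) (Ici 0) 0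
  deriv_ae : ∀ᵐ τ ∂(volume.restrict (Ioi (0 : ℝ))), HasDerivAt p (direction A b t (p τ)) τ

/-- The stopping test of the active set algorithm at the iterate `p` with least-squares solution
`u`: with `d = A D(p) u - b - t p` and `Δ` the maximal descent time along `d`, either `t > 0` and
`t Δ ≥ 1`, or `t = 0` and `d = 0`. -/
def AlgStops (A : Matrix (Fin m) (Fin n) ℝ) (b : Euc m) (t : ℝ) (p : Euc m)
    (u : Fin n → ℝ) : Prop :=
  (0 < t ∧ 1 ≤ (t : EReal) * maxDescentTime A p (nnlsResidual A b t p u)) ∨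
    (t = 0 ∧ nnlsResidual A b t p u = 0)

/-- `p k` and `u k` are the iterates and the least-squares solutions of a run of the active set
algorithm with input `p₀`. The solver of the least-squares problem is free to return any
solution, and entries past the first index at which the algorithm stops are arbitrary. -/
structure IsAlgRun (A : Matrix (Fin m) (Fin n) ℝ) (b : Euc m) (t : ℝ) (p₀ : Euc m)
    (p : ℕ → Euc m) (u : ℕ → Fin n → ℝ) : Prop where
  init : p 0 = p₀
  nnls : ∀ k, (∀ i < k, ¬ AlgStops A b t (p i) (u i)) → u k ∈ nnlsSolutions A b t (p k)
  update : ∀ k, (∀ i ≤ k, ¬ AlgStops A b t (p i) (u i)) →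
    p (k + 1) = p k +
      (maxDescentTime A (p k) (nnlsResidual A b t (p k) (u k))).toReal •
        nnlsResidual A b t (p k) (u k)

/-- The primal output `D(p) u` of the algorithm when it stops at `p`, `u`. -/
def algPrimal (A : Matrix (Fin m) (Fin n) ℝ) (p : Euc m) (u : Fin n → ℝ) : Fin n → ℝ :=
  signMat A p *ᵥ u

open Classical in
/-- The dual output of the algorithm when it stops at `p`, `u`: `p + d / t` if `t > 0`, and `p` if
`t = 0`, where `d = A D(p) u - b - t p`. -/
def algDual (A : Matrix (Fin m) (Fin n) ℝ) (b : Euc m) (t : ℝ) (p : Euc m)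
    (u : Fin n → ℝ) : Euc m :=
  if 0 < t then p + (1 / t) • nnlsResidual A b t p u else p

end BPDN

end

open BPDN

/-!
The proof rests on one sign-free optimality certificate. Write `C = {p : ‖Aᵀ p‖_∞ ≤ 1}`; this is
`dom ∂V`. A `DescentCertificate` at `p ∈ C` consists of a vector `x` and a direction
`d = A x - b - t p` such that `‖x‖₁ = -⟨A x, p⟩`, `⟨A x, d⟩ = 0` and `p + ε d ∈ C` for some `ε > 0`.
Since `⟨A x, q⟩ ≥ -‖x‖₁` on `C`, the vector `-d` is a subgradient at `p`; testing any other
subgradient along the feasible direction `d` shows that `-d` has least norm. Hence `d` is the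
direction of the slow system (`DescentCertificate.direction_eq`), and Farkas' lemma is not needed.
Certificates exist: finitely generated cones are closed (`isClosed_coneOn`), so the nonnegative
least-squares problem has a solution, whose optimality conditions are a certificate
(`descentCertificate_of_mem_nnlsSolutions`). In particular all its solutions have residual `d`.

The maximal descent time is the largest `s` with `p + s d ∈ C` (`coe_le_maxDescentTime_iff`). A
certificate `(x, d)` at `p` gives the certificate `(x, (1 - t s) d)` at `p + s d` as long as the ray
stays in `C` beyond `s`, or `t s = 1` (`DescentCertificate.along_ray`); this yields the explicit
formula on each piece, and shows that a step of length `1 / t` ends at a zero direction.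

Finite termination follows from the behaviour of `z = A x`. At a breakpoint where the ray leaves
`C`, `‖z‖` strictly increases (`DescentCertificate.norm_lt_of_breakpoint`), while `z` is determined
by the signed set of active constraints
(`DescentCertificate.applyMat_eq_of_activePattern_eq`), of which there are finitely many. This
argument treats `t = 0` and `t > 0` alike.

The slow solution is a finite sum of truncated profiles, hence Lipschitz. It is unique because the
subdifferential is monotone: the squared distance of two solutions is absolutely continuous with
almost everywhere nonpositive derivative. A certificate with `d = 0` proves optimality of `x` and
`p` by weak duality, and until it stops the active set algorithm visits the breakpoints of the slow
solution.
-/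

namespace BPDN

/-! ### Finitely generated cones are closed -/

section FiniteCones

variable {E : Type*} [NormedAddCommGroup E] [NormedSpace ℝ E]

/-- The cone of nonnegative combinations of the vectors `w j`, `j ∈ S`. The coefficients are
indexed by the whole type and vanish off `S`. -/
def coneOn {ι : Type*} [Fintype ι] (w : ι → E) (S : Finset ι) : Set E :=
  {x | ∃ u : ι → ℝ, (∀ j, 0 ≤ u j) ∧ (∀ j ∉ S, u j = 0) ∧ x = ∑ j, u j • w j}

theorem isClosed_coneOn_of_linearIndepOn {ι : Type*} [Fintype ι] (w : ι → E) (S : Finset ι)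
    (hw : LinearIndepOn ℝ w (S : Set ι)) : IsClosed (coneOn w S) := by
  classical
  have hinj : Function.Injective (Fintype.linearCombination ℝ (fun j : S => w j)) :=
    linearIndependent_iff_injective_fintypeLinearCombination.1 hw
  have hemb := LinearMap.isClosedEmbedding_of_injective (LinearMap.ker_eq_bot.2 hinj)
  have himage : coneOn w S =
      Fintype.linearCombination ℝ (fun j : S => w j) '' {v | ∀ j, 0 ≤ v j} := by
    ext x
    constructor
    · rintro ⟨u, hu, hS, rfl⟩
      refine ⟨fun j => u j, fun j => hu j, ?_⟩
      rw [Fintype.linearCombination_apply, Finset.sum_coe_sort S (fun j => u j • w j)]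
      exact Finset.sum_subset (Finset.subset_univ S) fun j _ hj => by rw [hS j hj, zero_smul]
    · rintro ⟨v, hv, rfl⟩
      refine ⟨fun j => if h : j ∈ S then v ⟨j, h⟩ else 0, fun j => ?_, fun j hj => ?_, ?_⟩
      · dsimp only
        split_ifs with h
        exacts [hv _, le_rfl]
      · simp [hj]
      · rw [Fintype.linearCombination_apply,
          ← Finset.sum_subset (Finset.subset_univ S) fun j _ hj => by simp [hj],
          ← Finset.sum_coe_sort S]
        exact Finset.sum_congr rfl fun j _ => by simp
  rw [himage]
  refine hemb.isClosedMap _ ?_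
  simp only [ofPred_forall]
  exact isClosed_iInter fun j => isClosed_le continuous_const (continuous_apply j)

/-- Carathéodory's reduction: moving along a linear relation until a first coefficient vanishes
removes one of the generators. -/
theorem exists_mem_coneOn_erase {ι : Type*} [Fintype ι] [DecidableEq ι] (w : ι → E)
    (S : Finset ι) (hw : ¬ LinearIndepOn ℝ w (S : Set ι)) {x : E} (hx : x ∈ coneOn w S) :
    ∃ j ∈ S, x ∈ coneOn w (S.erase j) := by
  obtain ⟨u, hu, hS, rfl⟩ := hx
  obtain ⟨c, hcS, hc0, i, hi⟩ : ∃ c : ι → ℝ, (∀ j ∉ S, c j = 0) ∧ ∑ j, c j • w j = 0 ∧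
      ∃ i, 0 < c i := by
    rw [linearIndepOn_finset_iff] at hw
    push Not at hw
    obtain ⟨g, hg, i, hiS, hi⟩ := hw
    have hsum : ∑ j, (if j ∈ S then g j else 0) • w j = 0 := by
      rw [← hg, ← Finset.sum_subset (Finset.subset_univ S) fun j _ hj => by simp [hj]]
      exact Finset.sum_congr rfl fun j hj => by simp [hj]
    rcases lt_or_gt_of_ne hi with h | h
    · refine ⟨fun j => -(if j ∈ S then g j else 0), fun j hj => by simp [hj], ?_, i, ?_⟩
      · simp only [neg_smul, Finset.sum_neg_distrib, hsum, neg_zero]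
      · simpa [hiS] using h
    · exact ⟨fun j => if j ∈ S then g j else 0, fun j hj => by simp [hj], hsum, i,
        by simpa [hiS] using h⟩
  -- The index whose coefficient vanishes first as multiples of `c` are subtracted from `u`.
  obtain ⟨k, hk, hmin⟩ := Finset.exists_min_image (Finset.univ.filter fun j => 0 < c j)
    (fun j => u j / c j) ⟨i, by simpa using hi⟩
  simp only [Finset.mem_filter, Finset.mem_univ, true_and] at hk hmin
  have hkS : k ∈ S := by
    by_contra h
    exact hk.ne' (hcS k h)
  refine ⟨k, hkS, fun j => u j - u k / c k * c j, fun j => ?_, fun j hj => ?_, ?_⟩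
  · have hq : 0 ≤ u k / c k := div_nonneg (hu k) hk.le
    rcases lt_or_ge 0 (c j) with h | h
    · have := (le_div_iff₀ h).1 (hmin j h)
      linarith
    · have := mul_nonpos_of_nonneg_of_nonpos hq h
      linarith [hu j]
  · by_cases hjk : j = k
    · subst hjk
      dsimp only
      rw [div_mul_cancel₀ _ hk.ne', sub_self]
    · have : j ∉ S := fun h => hj (Finset.mem_erase.2 ⟨hjk, h⟩)
      simp [hS j this, hcS j this]
  · simp only [sub_smul, Finset.sum_sub_distrib, mul_smul, ← Finset.smul_sum, hc0, smul_zero,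
      sub_zero]

theorem isClosed_coneOn {ι : Type*} [Fintype ι] (w : ι → E) (S : Finset ι) :
    IsClosed (coneOn w S) := by
  classical
  induction S using Finset.strongInduction with
  | H S ih =>
    by_cases hw : LinearIndepOn ℝ w (S : Set ι)
    · exact isClosed_coneOn_of_linearIndepOn w S hw
    · have : coneOn w S = ⋃ j ∈ S, coneOn w (S.erase j) := by
        ext x
        simp only [mem_iUnion, exists_prop]
        refine ⟨exists_mem_coneOn_erase w S hw, ?_⟩
        rintro ⟨j, -, u, hu, hS, rfl⟩
        exact ⟨u, hu, fun i hi => hS i fun h => hi (Finset.mem_of_mem_erase h), rfl⟩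
      rw [this]
      exact S.finite_toSet.isClosed_biUnion fun j hj => ih _ (Finset.erase_ssubset hj)

end FiniteCones

/-! ### The dual polytope and the subdifferential -/

variable {m n : ℕ} {A : Matrix (Fin m) (Fin n) ℝ} {b : Euc m} {t : ℝ}

theorem applyTr_add (A : Matrix (Fin m) (Fin n) ℝ) (p q : Euc m) :
    applyTr A (p + q) = applyTr A p + applyTr A q := Matrix.mulVec_add _ _ _

theorem applyTr_smul (A : Matrix (Fin m) (Fin n) ℝ) (c : ℝ) (p : Euc m) :
    applyTr A (c • p) = c • applyTr A p := Matrix.mulVec_smul _ _ _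

theorem applyTr_zero (A : Matrix (Fin m) (Fin n) ℝ) : applyTr A 0 = 0 := Matrix.mulVec_zero _

theorem applyTr_add_smul_apply (A : Matrix (Fin m) (Fin n) ℝ) (p d : Euc m) (s : ℝ) (j : Fin n) :
    applyTr A (p + s • d) j = applyTr A p j + s * applyTr A d j := by
  simp [applyTr_add, applyTr_smul]

theorem applyMat_add (A : Matrix (Fin m) (Fin n) ℝ) (x y : Fin n → ℝ) :
    applyMat A (x + y) = applyMat A x + applyMat A y := by
  simp [applyMat, Matrix.mulVec_add]

theorem applyMat_smul (A : Matrix (Fin m) (Fin n) ℝ) (c : ℝ) (x : Fin n → ℝ) :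
    applyMat A (c • x) = c • applyMat A x := by
  simp [applyMat, Matrix.mulVec_smul]

/-- `applyMat A` and `applyTr A` are adjoint. -/
theorem inner_applyMat (A : Matrix (Fin m) (Fin n) ℝ) (x : Fin n → ℝ) (p : Euc m) :
    inner ℝ (applyMat A x) p = ∑ j, x j * applyTr A p j := by
  have : inner ℝ (applyMat A x) p = x ⬝ᵥ applyTr A p := by
    rw [applyTr, Matrix.dotProduct_mulVec, Matrix.vecMul_transpose, dotProduct_comm]
    rfl
  rw [this]
  rfl

/-- A matrix of full row rank has an injective transpose. -/
theorem eq_zero_of_applyTr_eq_zero (hA : A.rank = m) {d : Euc m} (h : ∀ j, applyTr A d j = 0) :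
    d = 0 := by
  have hrank : Module.finrank ℝ (LinearMap.range (Aᵀ).mulVecLin) = m := by
    rw [← Matrix.rank, Matrix.rank_transpose, hA]
  have hker := LinearMap.finrank_range_add_finrank_ker (Aᵀ).mulVecLin
  rw [hrank, Module.finrank_fin_fun] at hker
  have hbot : LinearMap.ker (Aᵀ).mulVecLin = ⊥ := Submodule.finrank_eq_zero.1 (by omega)
  have : d.ofLp ∈ LinearMap.ker (Aᵀ).mulVecLin := by
    rw [LinearMap.mem_ker]
    exact funext h
  rw [hbot, Submodule.mem_bot] at this
  exact (WithLp.ofLp_eq_zero 2).1 this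

/-- The feasible polytope `{p : ‖Aᵀ p‖_∞ ≤ 1}` of the dual problem. -/
def dualFeasible (A : Matrix (Fin m) (Fin n) ℝ) : Set (Euc m) :=
  {p | ∀ j, |applyTr A p j| ≤ 1}

/-- The finite part `(t / 2) ‖p‖² + ⟨p, b⟩` of the dual objective. -/
noncomputable def smoothPart (b : Euc m) (t : ℝ) (p : Euc m) : ℝ := t / 2 * ‖p‖ ^ 2 + inner ℝ p b

theorem potential_of_mem (b : Euc m) (t : ℝ) {p : Euc m} (hp : p ∈ dualFeasible A) :
    potential A b t p = (smoothPart b t p : ℝ) := by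
  have : ∀ j, |(-applyTr A p) j| ≤ 1 := fun j => by simpa using hp j
  simp [potential, charBall, this, smoothPart, -Pi.neg_apply]

theorem potential_of_notMem (b : Euc m) (t : ℝ) {p : Euc m} (hp : p ∉ dualFeasible A) :
    potential A b t p = ⊤ := by
  have : ¬ ∀ j, |(-applyTr A p) j| ≤ 1 := fun h => hp fun j => by simpa using h j
  simp only [potential, charBall, if_neg this]
  exact EReal.coe_add_top _

theorem mem_dualFeasible_of_potential_lt_top {p : Euc m} (h : potential A b t p < ⊤) :
    p ∈ dualFeasible A := by
  by_contra hp
  exact h.ne (potential_of_notMem b t hp)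

theorem mem_subdifferential_potential {p s : Euc m} :
    s ∈ subdifferential (potential A b t) p ↔ p ∈ dualFeasible A ∧
      ∀ q ∈ dualFeasible A, smoothPart b t p + inner ℝ s (q - p) ≤ smoothPart b t q := by
  constructor
  · rintro ⟨hlt, h⟩
    have hp := mem_dualFeasible_of_potential_lt_top hlt
    refine ⟨hp, fun q hq => ?_⟩
    have := h q
    rw [potential_of_mem b t hp, potential_of_mem b t hq] at this
    exact_mod_cast this
  · rintro ⟨hp, h⟩
    refine ⟨by rw [potential_of_mem b t hp]; exact EReal.coe_lt_top _, fun q => ?_⟩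
    by_cases hq : q ∈ dualFeasible A
    · rw [potential_of_mem b t hp, potential_of_mem b t hq]
      exact_mod_cast h q hq
    · rw [potential_of_notMem b t hq]
      exact le_top

/-- Weak duality for the `ℓ¹` norm: `⟨A x, q⟩ = ⟨x, Aᵀ q⟩ ≥ -‖x‖₁` on the dual polytope. -/
theorem neg_normOne_le_inner_applyMat {q : Euc m} (hq : q ∈ dualFeasible A) (x : Fin n → ℝ) :
    -normOne x ≤ inner ℝ (applyMat A x) q := by
  rw [inner_applyMat, normOne, ← Finset.sum_neg_distrib]
  refine Finset.sum_le_sum fun j _ => ?_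
  have h1 : |x j * applyTr A q j| ≤ |x j| := by
    rw [abs_mul]
    exact mul_le_of_le_one_right (abs_nonneg _) (hq j)
  exact (abs_le.1 h1).1

theorem smoothPart_sub (b : Euc m) (t : ℝ) (p q : Euc m) :
    smoothPart b t q - smoothPart b t p =
      t / 2 * ‖q - p‖ ^ 2 + inner ℝ (b + t • p) (q - p) := by
  have h : ‖q‖ ^ 2 = ‖q - p‖ ^ 2 + 2 * inner ℝ p (q - p) + ‖p‖ ^ 2 := by
    have := norm_add_sq_real (q - p) p
    rw [sub_add_cancel, real_inner_comm] at this
    exact this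
  simp only [smoothPart, h, inner_add_left, real_inner_smul_left, inner_sub_right,
    real_inner_comm b]
  ring

theorem smoothPart_add_smul (b : Euc m) (t s : ℝ) (p d : Euc m) :
    smoothPart b t (p + s • d) =
      smoothPart b t p + s * inner ℝ (b + t • p) d + s ^ 2 * (t / 2 * ‖d‖ ^ 2) := by
  have := smoothPart_sub b t p (p + s • d)
  rw [add_sub_cancel_left, norm_smul, mul_pow, Real.norm_eq_abs, sq_abs,
    real_inner_smul_right] at this
  linarith

theorem convex_dualFeasible (A : Matrix (Fin m) (Fin n) ℝ) : Convex ℝ (dualFeasible A) := by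
  intro p hp q hq α β hα hβ hαβ j
  have h1 := abs_le.1 (hp j)
  have h2 := abs_le.1 (hq j)
  rw [applyTr_add, applyTr_smul, applyTr_smul]
  simp only [Pi.add_apply, Pi.smul_apply, smul_eq_mul]
  rw [abs_le]
  constructor <;> nlinarith

/-- Feasibility along a ray persists at smaller times. -/
theorem add_smul_mem_dualFeasible_of_le {p d : Euc m} (hp : p ∈ dualFeasible A) {r s : ℝ}
    (hr : 0 ≤ r) (hrs : r ≤ s) (hs : p + s • d ∈ dualFeasible A) :
    p + r • d ∈ dualFeasible A := by
  rcases hr.eq_or_lt with rfl | hr'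
  · simpa using hp
  have hs0 : 0 < s := hr'.trans_le hrs
  have := convex_dualFeasible A hp hs (a := 1 - r / s) (b := r / s)
    (sub_nonneg.2 ((div_le_one hs0).2 hrs)) (by positivity) (by ring)
  convert this using 1
  rw [smul_add, smul_smul, div_mul_cancel₀ _ hs0.ne', ← add_assoc, ← add_smul, sub_add_cancel,
    one_smul]

/-- `d` is a feasible direction of the dual polytope as soon as it does not point out of an active
constraint. -/
theorem exists_pos_add_smul_mem {p d : Euc m} (hp : p ∈ dualFeasible A)
    (hd : ∀ j, |applyTr A p j| = 1 → applyTr A p j * applyTr A d j ≤ 0) :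
    ∃ ε : ℝ, 0 < ε ∧ p + ε • d ∈ dualFeasible A := by
  have hev : ∀ j, ∀ᶠ ε in 𝓝[>] (0 : ℝ), |applyTr A (p + ε • d) j| ≤ 1 := by
    intro j
    have hcont : Tendsto (fun ε : ℝ => applyTr A p j + ε * applyTr A d j) (𝓝[>] 0)
        (𝓝 (applyTr A p j)) := by
      have : Continuous fun ε : ℝ => applyTr A p j + ε * applyTr A d j := by fun_prop
      simpa using (this.tendsto 0).mono_left nhdsWithin_le_nhds
    have hpj := abs_le.1 (hp j)
    simp only [applyTr_add_smul_apply, abs_le]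
    rcases (hp j).lt_or_eq with hlt | heq
    · have := abs_lt.1 hlt
      filter_upwards [hcont.eventually (Ioo_mem_nhds this.1 this.2)] with ε hε
      exact ⟨hε.1.le, hε.2.le⟩
    · have hdj := hd j heq
      rcases eq_or_eq_neg_of_abs_eq heq with h1 | h1
      · filter_upwards [hcont.eventually (Ioi_mem_nhds (show -1 < applyTr A p j by linarith)),
          self_mem_nhdsWithin] with ε hε hpos
        refine ⟨le_of_lt hε, ?_⟩
        rw [h1] at hdj ⊢
        nlinarith [mem_Ioi.1 hpos]
      · filter_upwards [hcont.eventually (Iio_mem_nhds (show applyTr A p j < 1 by linarith)),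
          self_mem_nhdsWithin] with ε hε hpos
        refine ⟨?_, le_of_lt hε⟩
        rw [h1] at hdj ⊢
        nlinarith [mem_Ioi.1 hpos]
  obtain ⟨ε, h1, h2⟩ := ((eventually_all.2 hev).and self_mem_nhdsWithin).exists
  exact ⟨ε, h2, h1⟩

/-! ### Certificates of steepest descent -/

/-- A certificate that `d` is the steepest descent direction of the dual objective at `p`:
at the feasible point `p`, the functional `⟨A x, ·⟩` attains its lower bound `-‖x‖₁` on the dual
polytope, `d = A x - b - t p` is orthogonal to `A x`, and `d` is a feasible direction. In terms of
the active constraints, these are the optimality conditions of the nonnegative least-squares problem at `p`. -/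
structure DescentCertificate (A : Matrix (Fin m) (Fin n) ℝ) (b : Euc m) (t : ℝ) (p : Euc m)
    (x : Fin n → ℝ) (d : Euc m) : Prop where
  mem : p ∈ dualFeasible A
  eq : applyMat A x = d + b + t • p
  normOne_eq : normOne x = -inner ℝ (applyMat A x) p
  orthogonal : inner ℝ (applyMat A x) d = 0
  feasible : ∃ ε : ℝ, 0 < ε ∧ p + ε • d ∈ dualFeasible A

/-- First-order optimality along a ray: the linear coefficient of a parabola bounded below by its
value at the left end point is nonnegative. -/
theorem nonneg_of_forall_quadratic {a c δ : ℝ} (hδ : 0 < δ)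
    (h : ∀ s, 0 < s → s ≤ δ → 0 ≤ s * a + s ^ 2 * c) : 0 ≤ a := by
  by_contra! ha
  have hs : 0 < min δ (-a / (2 * (|c| + 1))) := lt_min hδ (div_pos (neg_pos.2 ha) (by positivity))
  have hle := h _ hs (min_le_left _ _)
  set s := min δ (-a / (2 * (|c| + 1)))
  have h1 : s * (2 * (|c| + 1)) ≤ -a :=
    (le_div_iff₀ (by positivity)).1 (min_le_right _ _)
  have h2 : 0 ≤ a + s * c := by
    by_contra! hneg
    nlinarith
  nlinarith [le_abs_self c, mul_le_mul_of_nonneg_left (le_abs_self c) hs.le]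

/-- The functional `⟨A x, ·⟩` is nonnegative on the feasible directions at a point `p` where it
attains its lower bound `-‖x‖₁` on the dual polytope. -/
theorem inner_nonneg_of_feasible {p d : Euc m} {x : Fin n → ℝ}
    (hp : normOne x = -inner ℝ (applyMat A x) p) {ε : ℝ} (hε : 0 < ε)
    (hd : p + ε • d ∈ dualFeasible A) : 0 ≤ inner ℝ (applyMat A x) d := by
  have := neg_normOne_le_inner_applyMat hd x
  rw [inner_add_right, real_inner_smul_right] at this
  exact nonneg_of_mul_nonneg_right (by linarith) hε

namespace DescentCertificate

variable {p d : Euc m} {x : Fin n → ℝ}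

theorem neg_mem_subdifferential (ht : 0 ≤ t) (h : DescentCertificate A b t p x d) :
    -d ∈ subdifferential (potential A b t) p := by
  refine mem_subdifferential_potential.2 ⟨h.mem, fun q hq => ?_⟩
  have h1 := smoothPart_sub b t p q
  have h2 := neg_normOne_le_inner_applyMat hq x
  have h3 : inner ℝ (applyMat A x) (q - p) = inner ℝ (b + t • p) (q - p) + inner ℝ d (q - p) := by
    rw [h.eq, add_assoc, inner_add_left]
    ring
  have h4 := h.normOne_eq
  rw [inner_sub_right] at h3
  rw [inner_neg_left]
  have : 0 ≤ t / 2 * ‖q - p‖ ^ 2 := by positivity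
  linarith

/-- Every subgradient `s` at `p` satisfies `⟨s, d⟩ ≤ -‖d‖²`, as `d` is a feasible direction along
which the objective has slope `-‖d‖²`. -/
theorem inner_subgradient_le (h : DescentCertificate A b t p x d) {s : Euc m}
    (hs : s ∈ subdifferential (potential A b t) p) : inner ℝ s d ≤ -‖d‖ ^ 2 := by
  obtain ⟨ε, hε, hmem⟩ := h.feasible
  obtain ⟨-, hs⟩ := mem_subdifferential_potential.1 hs
  have hlin : inner ℝ (b + t • p) d = -‖d‖ ^ 2 := by
    have := h.orthogonal
    rw [h.eq, add_assoc, inner_add_left, real_inner_self_eq_norm_sq] at this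
    linarith
  have key := nonneg_of_forall_quadratic (a := inner ℝ (b + t • p) d - inner ℝ s d)
    (c := t / 2 * ‖d‖ ^ 2) hε fun r hr hrε => by
      have := hs _ (add_smul_mem_dualFeasible_of_le h.mem hr.le hrε hmem)
      rw [smoothPart_add_smul, add_sub_cancel_left, real_inner_smul_right] at this
      linarith
  linarith

/-- The norm-minimal subgradient at `p` is `-d`: by `inner_subgradient_le`, every subgradient `s`
satisfies `‖s + d‖² ≤ ‖s‖² - ‖d‖²`. -/
theorem direction_eq (ht : 0 ≤ t) (h : DescentCertificate A b t p x d) :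
    direction A b t p = d := by
  have hmin : ∀ s ∈ subdifferential (potential A b t) p, ‖s + d‖ ^ 2 ≤ ‖s‖ ^ 2 - ‖d‖ ^ 2 := by
    intro s hs
    rw [norm_add_sq_real]
    linarith [h.inner_subgradient_le hs]
  have hex : ∃ y ∈ subdifferential (potential A b t) p,
      ∀ z ∈ subdifferential (potential A b t) p, ‖(0 : Euc m) - y‖ ≤ ‖0 - z‖ := by
    refine ⟨-d, h.neg_mem_subdifferential ht, fun z hz => ?_⟩
    simp only [zero_sub, norm_neg]
    have := hmin z hz
    exact le_of_sq_le_sq (by nlinarith [sq_nonneg ‖z + d‖]) (norm_nonneg _)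
  obtain ⟨h1, h2⟩ := hex.choose_spec
  rw [direction, proj, dif_pos hex]
  set y := hex.choose
  have h3 := h2 _ (h.neg_mem_subdifferential ht)
  simp only [zero_sub, norm_neg] at h3
  have h4 := hmin y h1
  have h5 : ‖y‖ ^ 2 ≤ ‖d‖ ^ 2 := by gcongr
  have h6 : ‖y + d‖ = 0 := by
    have : ‖y + d‖ ^ 2 ≤ 0 := by linarith
    exact pow_eq_zero_iff two_ne_zero |>.1 (le_antisymm this (sq_nonneg _))
  exact neg_eq_of_add_eq_zero_right (norm_eq_zero.1 h6)

/-- A certificate at `p` persists along the ray `p + s d`: the direction keeps its orientation and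
is scaled by `1 - t s`. -/
theorem along_ray (h : DescentCertificate A b t p x d) {s r : ℝ} (hs : 0 ≤ s)
    (hsr : s < r ∧ t * s ≤ 1 ∨ s = r ∧ t * s = 1) (hr : p + r • d ∈ dualFeasible A) :
    DescentCertificate A b t (p + s • d) x ((1 - t * s) • d) where
  mem := add_smul_mem_dualFeasible_of_le h.mem hs (by rcases hsr with h | h <;> linarith [h.1]) hr
  eq := by
    rw [h.eq]
    module
  normOne_eq := by
    rw [inner_add_right, real_inner_smul_right, h.orthogonal, h.normOne_eq]
    ring
  orthogonal := by rw [real_inner_smul_right, h.orthogonal, mul_zero]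
  feasible := by
    have hmem := add_smul_mem_dualFeasible_of_le h.mem hs
      (by rcases hsr with h | h <;> linarith [h.1]) hr
    rcases eq_or_ne (t * s) 1 with h1 | h1
    · exact ⟨1, one_pos, by simpa [h1] using hmem⟩
    · have hsr : s < r ∧ t * s ≤ 1 := hsr.resolve_right fun h => h1 h.2
      have hpos : 0 < 1 - t * s := sub_pos.2 (lt_of_le_of_ne hsr.2 h1)
      refine ⟨(r - s) / (1 - t * s), div_pos (sub_pos.2 hsr.1) hpos, ?_⟩
      rwa [smul_smul, div_mul_cancel₀ _ hpos.ne', add_assoc, ← add_smul, add_sub_cancel]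

/-- Complementary slackness: `x j` is nonzero only if the `j`-th constraint is active at `p`, and
then it has the sign opposite to that of `(Aᵀ p)_j`. -/
theorem abs_apply_eq (h : DescentCertificate A b t p x d) (j : Fin n) :
    |x j| = -(x j * applyTr A p j) := by
  have hsum : ∑ j, (|x j| + x j * applyTr A p j) = 0 := by
    rw [Finset.sum_add_distrib, ← inner_applyMat]
    have := h.normOne_eq
    rw [normOne] at this
    linarith
  have hnn : ∀ j ∈ Finset.univ, 0 ≤ |x j| + x j * applyTr A p j := by
    intro j _
    have h1 : |x j * applyTr A p j| ≤ |x j| := by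
      rw [abs_mul]
      exact mul_le_of_le_one_right (abs_nonneg _) (h.mem j)
    linarith [neg_le_of_abs_le h1]
  linarith [(Finset.sum_eq_zero_iff_of_nonneg hnn).1 hsum j (Finset.mem_univ j)]

end DescentCertificate

/-- The active constraints at `p`, with their signs. -/
def activePattern (A : Matrix (Fin m) (Fin n) ℝ) (p : Euc m) : Fin n → Prop × Prop :=
  fun j => (applyTr A p j = 1, applyTr A p j = -1)

namespace DescentCertificate

variable {p d p' d' : Euc m} {x x' : Fin n → ℝ}

theorem normOne_eq_of_activePattern_eq (h : DescentCertificate A b t p x d)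
    (hpat : activePattern A p = activePattern A p') :
    normOne x = -inner ℝ (applyMat A x) p' := by
  rw [h.normOne_eq, inner_applyMat, inner_applyMat]
  congr 1
  refine Finset.sum_congr rfl fun j _ => ?_
  rcases eq_or_ne (x j) 0 with h0 | h0
  · simp [h0]
  have h1 := h.abs_apply_eq j
  have h2 := congrFun hpat j
  simp only [activePattern, Prod.mk.injEq, eq_iff_iff] at h2
  rcases abs_cases (x j) with ⟨hx, -⟩ | ⟨hx, -⟩
  · have h3 : applyTr A p j = -1 := mul_left_cancel₀ h0 (by linarith)
    rw [h3, h2.2.1 h3]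
  · have h3 : applyTr A p j = 1 := mul_left_cancel₀ h0 (by linarith)
    rw [h3, h2.1.1 h3]

/-- The vector `A x` of a certificate depends on `p` only through the signed active set: it is the
point of least norm of a polyhedron determined by the active constraints. -/
theorem applyMat_eq_of_activePattern_eq (h : DescentCertificate A b t p x d)
    (h' : DescentCertificate A b t p' x' d') (hpat : activePattern A p = activePattern A p') :
    applyMat A x = applyMat A x' := by
  obtain ⟨ε, hε, hd⟩ := h.feasible
  obtain ⟨ε', hε', hd'⟩ := h'.feasible
  have e1 := h.normOne_eq_of_activePattern_eq hpat
  have e2 := h'.normOne_eq_of_activePattern_eq hpat.symm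
  have i1 := inner_nonneg_of_feasible e1 hε' hd'
  have i2 := inner_nonneg_of_feasible e2 hε hd
  have j1 := h.normOne_eq.symm.trans e1
  have j2 := h'.normOne_eq.symm.trans e2
  have o1 := h.orthogonal
  have o2 := h'.orthogonal
  have hz : applyMat A x - applyMat A x' = d - d' + t • (p - p') := by
    rw [h.eq, h'.eq]
    module
  set z := applyMat A x
  set z' := applyMat A x'
  have hn : ‖z - z'‖ ^ 2 ≤ 0 := by
    have : inner ℝ (z - z') (z - z') = inner ℝ (z - z') (d - d' + t • (p - p')) := by rw [← hz]
    rw [real_inner_self_eq_norm_sq, inner_add_right, real_inner_smul_right] at this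
    simp only [inner_sub_left, inner_sub_right] at this
    rw [this]
    have k1 : inner ℝ z p = inner ℝ z p' := neg_injective j1
    have k2 : inner ℝ z' p = inner ℝ z' p' := (neg_injective j2).symm
    rw [k1, k2]
    linarith
  exact sub_eq_zero.1 (norm_eq_zero.1 (pow_eq_zero_iff two_ne_zero |>.1
    (le_antisymm hn (sq_nonneg _))))

/-- At a breakpoint `p + s d` where the ray leaves the polytope before `t s` reaches `1`, the norm
of the vector `A x` strictly increases: `⟨A x, A x' - A x⟩ = ⟨A x, d'⟩ ≥ 0`, and `A x' = A x` would
make `d'` a positive multiple of `d`, which is no longer a feasible direction. -/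
theorem norm_lt_of_breakpoint (h : DescentCertificate A b t p x d) {s : ℝ} (hts : t * s < 1)
    (h' : DescentCertificate A b t (p + s • d) x' d')
    (hmax : ∀ r, s < r → p + r • d ∉ dualFeasible A) :
    ‖applyMat A x‖ ^ 2 < ‖applyMat A x'‖ ^ 2 := by
  obtain ⟨ε, hε, hd'⟩ := h'.feasible
  have e1 : normOne x = -inner ℝ (applyMat A x) (p + s • d) := by
    rw [inner_add_right, real_inner_smul_right, h.orthogonal, h.normOne_eq]
    ring
  have i1 := inner_nonneg_of_feasible e1 hε hd'
  have hz : applyMat A x' = applyMat A x + (d' - (1 - t * s) • d) := by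
    rw [h.eq, h'.eq]
    module
  have hne : d' - (1 - t * s) • d ≠ 0 := by
    intro h0
    rw [sub_eq_zero.1 h0, smul_smul, add_assoc, ← add_smul] at hd'
    exact hmax _ (lt_add_of_pos_right s (mul_pos hε (sub_pos.2 hts))) hd'
  rw [hz, norm_add_sq_real, inner_sub_right, real_inner_smul_right, h.orthogonal]
  have : 0 < ‖d' - (1 - t * s) • d‖ ^ 2 := by positivity
  linarith

end DescentCertificate

/-! ### The maximal descent time -/

theorem sgn_mul_self (a : ℝ) : sgn a * sgn a = 1 := by
  unfold sgn
  split_ifs <;> norm_num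

theorem abs_sgn (a : ℝ) : |sgn a| = 1 := by
  unfold sgn
  split_ifs <;> norm_num

theorem sgn_mul (a : ℝ) : sgn a * a = |a| := by
  unfold sgn
  split_ifs with h
  · rw [abs_of_nonneg h, one_mul]
  · rw [abs_of_neg (not_le.1 h), neg_one_mul]

theorem signMat_mulVec_apply (A : Matrix (Fin m) (Fin n) ℝ) (p : Euc m) (u : Fin n → ℝ)
    (j : Fin n) : (signMat A p *ᵥ u) j = sgn (-applyTr A p j) * u j := by
  simp [signMat, Matrix.mulVec_diagonal]

/-- The maximal descent time is the largest time up to which the ray stays feasible. -/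
theorem coe_le_maxDescentTime_iff {p d : Euc m} (hp : p ∈ dualFeasible A) {s : ℝ} (hs : 0 ≤ s) :
    (s : EReal) ≤ maxDescentTime A p d ↔ p + s • d ∈ dualFeasible A := by
  simp only [maxDescentTime, le_iInf_iff]
  refine forall_congr' fun j => ?_
  have habs : |applyTr A (p + s • d) j| =
      |(signMat A p *ᵥ applyTr A p) j + s * (signMat A p *ᵥ applyTr A d) j| := by
    rw [applyTr_add_smul_apply, signMat_mulVec_apply, signMat_mulVec_apply, mul_left_comm,
      ← mul_add, abs_mul, abs_sgn, one_mul]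
  have hα : |(signMat A p *ᵥ applyTr A p) j| ≤ 1 := by
    rw [signMat_mulVec_apply, abs_mul, abs_sgn, one_mul]
    exact hp j
  rw [habs]
  set α := (signMat A p *ᵥ applyTr A p) j
  set δ := (signMat A p *ᵥ applyTr A d) j
  have hα' := abs_le.1 hα
  split_ifs with h0
  · simpa [h0] using hα
  rw [EReal.coe_le_coe_iff, abs_le]
  rcases lt_or_gt_of_ne h0 with h | h
  · rw [sgn, if_neg (not_le.2 h), le_div_iff_of_neg h]
    constructor
    · intro h1
      constructor <;> nlinarith
    · rintro ⟨h1, -⟩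
      linarith
  · rw [sgn, if_pos h.le, le_div_iff₀ h]
    constructor
    · intro h1
      constructor <;> nlinarith
    · rintro ⟨-, h1⟩
      linarith

theorem maxDescentTime_zero_right (A : Matrix (Fin m) (Fin n) ℝ) (p : Euc m) :
    maxDescentTime A p 0 = ⊤ := by
  simp [maxDescentTime, applyTr_zero]

theorem maxDescentTime_nonneg {p : Euc m} (hp : p ∈ dualFeasible A) (d : Euc m) :
    0 ≤ maxDescentTime A p d := by
  have := (coe_le_maxDescentTime_iff (d := d) hp le_rfl).2 (by simpa using hp)
  simpa using this

theorem maxDescentTime_lt_top (hA : A.rank = m) {d : Euc m} (hd : d ≠ 0) (p : Euc m) :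
    maxDescentTime A p d < ⊤ := by
  obtain ⟨j, hj⟩ : ∃ j, applyTr A d j ≠ 0 := by
    by_contra! h
    exact hd (eq_zero_of_applyTr_eq_zero hA h)
  refine (iInf_le _ j).trans_lt ?_
  rw [if_neg]
  · exact EReal.coe_lt_top _
  · rw [signMat_mulVec_apply]
    exact mul_ne_zero (fun h => by have := abs_sgn (-applyTr A p j); simp [h] at this) hj

/-! ### Nonnegative least squares -/

theorem nnlsResidual_add_smul (A : Matrix (Fin m) (Fin n) ℝ) (b : Euc m) (t : ℝ) (p : Euc m)
    (u h : Fin n → ℝ) (s : ℝ) : nnlsResidual A b t p (u + s • h) =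
      nnlsResidual A b t p u + s • applyMat A (signMat A p *ᵥ h) := by
  simp only [nnlsResidual, Matrix.mulVec_add, Matrix.mulVec_smul, applyMat_add, applyMat_smul]
  abel

theorem nnlsSolutions_nonempty (A : Matrix (Fin m) (Fin n) ℝ) (b : Euc m) (t : ℝ) (p : Euc m) :
    (nnlsSolutions A b t p).Nonempty := by
  classical
  set w : Fin n → Euc m := fun j => applyMat A (signMat A p *ᵥ Pi.single j 1) with hw
  set S : Finset (Fin n) := (equicorrelation A p).toFinset with hS
  have hsum : ∀ u : Fin n → ℝ, applyMat A (signMat A p *ᵥ u) = ∑ j, u j • w j := by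
    intro u
    have hlin : IsLinearMap ℝ fun u : Fin n → ℝ => applyMat A (signMat A p *ᵥ u) :=
      ⟨fun u v => by simp only [Matrix.mulVec_add, applyMat_add],
        fun c u => by simp only [Matrix.mulVec_smul, applyMat_smul]⟩
    have hu : u = ∑ j, u j • Pi.single j (1 : ℝ) := by
      ext i
      simp [Finset.sum_apply, Pi.single_apply]
    calc hlin.mk' _ u = hlin.mk' _ (∑ j, u j • Pi.single j (1 : ℝ)) := by rw [← hu]
      _ = ∑ j, u j • w j := by
        rw [map_sum]
        exact Finset.sum_congr rfl fun j _ => map_smul _ _ _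
  have hcone : ∀ u, u ∈ nnlsFeasible A p → applyMat A (signMat A p *ᵥ u) ∈ coneOn w S := by
    intro u hu
    refine ⟨u, fun j => ?_, fun j hj => hu.2 j (by simpa [hS] using hj), hsum u⟩
    by_cases hj : j ∈ equicorrelation A p
    · exact hu.1 j hj
    · exact (hu.2 j hj).ge
  have hne : (coneOn w S).Nonempty := ⟨0, 0, fun _ => le_rfl, fun _ _ => rfl, by simp⟩
  obtain ⟨z, ⟨u, hu, huS, rfl⟩, hz⟩ :=
    (isClosed_coneOn w S).exists_infDist_eq_dist hne (b + t • p)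
  have hres : ∀ v, ‖nnlsResidual A b t p v‖ = dist (b + t • p) (applyMat A (signMat A p *ᵥ v)) := by
    intro v
    rw [nnlsResidual, dist_comm, dist_eq_norm, sub_sub]
  refine ⟨u, ⟨fun j _ => hu j, fun j hj => huS j (by simpa [hS] using hj)⟩, fun v hv => ?_⟩
  rw [hres, hres, hsum u, ← hz]
  gcongr
  exacts [Metric.infDist_nonneg, Metric.infDist_le_dist_of_mem (hcone v hv)]

/-- A minimiser `u` of the least-squares problem yields a certificate: comparing `u` with `u ± s u`
gives orthogonality, comparing it with `u + s e_j` shows that the residual does not point out of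
the `j`-th active constraint. -/
theorem descentCertificate_of_mem_nnlsSolutions {p : Euc m} (hp : p ∈ dualFeasible A)
    {u : Fin n → ℝ} (hu : u ∈ nnlsSolutions A b t p) :
    DescentCertificate A b t p (signMat A p *ᵥ u) (nnlsResidual A b t p u) := by
  obtain ⟨⟨hpos, hzero⟩, hmin⟩ := hu
  have hmemE : ∀ j, j ∈ equicorrelation A p ↔ |applyTr A p j| = 1 := fun j => by
    simp [equicorrelation]
  have hnn : ∀ j, 0 ≤ u j := fun j => by
    by_cases hj : j ∈ equicorrelation A p
    · exact hpos j hj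
    · exact (hzero j hj).ge
  have hvar : ∀ (h : Fin n → ℝ), (∀ s : ℝ, 0 < s → s ≤ 1 → u + s • h ∈ nnlsFeasible A p) →
      0 ≤ inner ℝ (nnlsResidual A b t p u) (applyMat A (signMat A p *ᵥ h)) := by
    intro h hfeas
    have := nonneg_of_forall_quadratic
      (a := 2 * inner ℝ (nnlsResidual A b t p u) (applyMat A (signMat A p *ᵥ h)))
      (c := ‖applyMat A (signMat A p *ᵥ h)‖ ^ 2) one_pos fun s hs hs1 => by
        have h1 := hmin _ (hfeas s hs hs1)
        rw [nnlsResidual_add_smul, norm_add_sq_real, real_inner_smul_right, norm_smul, mul_pow,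
          Real.norm_eq_abs, sq_abs] at h1
        linarith
    linarith
  have horth : inner ℝ (applyMat A (signMat A p *ᵥ u)) (nnlsResidual A b t p u) = 0 := by
    rw [real_inner_comm]
    refine le_antisymm ?_ (hvar u fun s hs _ => ⟨fun j _ => ?_, fun j hj => ?_⟩)
    · have := hvar (-u) fun s hs hs1 => ⟨fun j _ => ?_, fun j hj => ?_⟩
      · rw [Matrix.mulVec_neg, ← neg_one_smul ℝ, applyMat_smul, real_inner_smul_right] at this
        linarith
      · have := mul_le_mul_of_nonneg_right hs1 (hnn j)
        simp only [Pi.add_apply, Pi.smul_apply, Pi.neg_apply, smul_eq_mul]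
        linarith
      · simp [hzero j hj]
    · have := mul_nonneg hs.le (hnn j)
      simp only [Pi.add_apply, Pi.smul_apply, smul_eq_mul]
      linarith [hnn j]
    · simp [hzero j hj]
  refine ⟨hp, by rw [nnlsResidual]; abel, ?_, horth, exists_pos_add_smul_mem hp fun j hj => ?_⟩
  · rw [normOne, inner_applyMat, ← Finset.sum_neg_distrib]
    refine Finset.sum_congr rfl fun j _ => ?_
    rw [signMat_mulVec_apply, abs_mul, abs_sgn, abs_of_nonneg (hnn j), one_mul]
    by_cases hj : j ∈ equicorrelation A p
    · have h1 := sgn_mul (-applyTr A p j)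
      rw [abs_neg, (hmemE j).1 hj] at h1
      linear_combination (-u j) * h1
    · simp [hzero j hj]
  · have h1 := hvar (Pi.single j 1) fun s hs _ => ⟨fun i _ => ?_, fun i hi => ?_⟩
    · rw [real_inner_comm, inner_applyMat, Finset.sum_eq_single j] at h1
      · rw [signMat_mulVec_apply, Pi.single_eq_same, mul_one] at h1
        have h2 := sgn_mul (-applyTr A p j)
        rw [abs_neg, hj] at h2
        have h3 := sgn_mul_self (-applyTr A p j)
        have h4 : applyTr A p j = -sgn (-applyTr A p j) := by
          linear_combination (-sgn (-applyTr A p j)) * h2 - applyTr A p j * h3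
        rw [h4]
        linarith
      · intro i _ hij
        rw [signMat_mulVec_apply, Pi.single_eq_of_ne hij, mul_zero, zero_mul]
      · simp
    · have : 0 ≤ s * (Pi.single j (1 : ℝ) : Fin n → ℝ) i :=
        mul_nonneg hs.le (by rw [Pi.single_apply]; split_ifs <;> norm_num)
      simp only [Pi.add_apply, Pi.smul_apply, smul_eq_mul]
      linarith [hnn i]
    · have hij : i ≠ j := fun h => hi ((hmemE i).2 (h ▸ hj))
      simp [hzero i hi, hij]

/-- All solutions of the least-squares problem at `p` have the same residual. -/
theorem nnlsResidual_eq_direction (ht : 0 ≤ t) {p : Euc m} (hp : p ∈ dualFeasible A)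
    {u : Fin n → ℝ} (hu : u ∈ nnlsSolutions A b t p) :
    nnlsResidual A b t p u = direction A b t p :=
  ((descentCertificate_of_mem_nnlsSolutions hp hu).direction_eq ht).symm

theorem exists_descentCertificate (b : Euc m) (ht : 0 ≤ t) {p : Euc m} (hp : p ∈ dualFeasible A) :
    ∃ x, DescentCertificate A b t p x (direction A b t p) := by
  obtain ⟨u, hu⟩ := nnlsSolutions_nonempty A b t p
  exact ⟨_, nnlsResidual_eq_direction ht hp hu ▸ descentCertificate_of_mem_nnlsSolutions hp hu⟩

theorem subdiffDomain_potential (b : Euc m) (ht : 0 ≤ t) :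
    subdiffDomain (potential A b t) = dualFeasible A := by
  ext p
  constructor
  · rintro ⟨s, hs⟩
    exact (mem_subdifferential_potential.1 hs).1
  · intro hp
    obtain ⟨x, hx⟩ := exists_descentCertificate b ht hp
    exact ⟨_, hx.neg_mem_subdifferential ht⟩

/-! ### Optimality -/

theorem isDualSolution_of_direction_eq_zero (ht : 0 ≤ t) {p : Euc m} (hp : p ∈ dualFeasible A)
    (hd : direction A b t p = 0) : IsDualSolution A b t p := by
  obtain ⟨x, hx⟩ := exists_descentCertificate b ht hp
  intro q
  have := (hx.neg_mem_subdifferential ht).2 q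
  simpa [hd] using this

theorem eq_of_isDualSolution (ht : 0 < t) {p q : Euc m} (hp : p ∈ dualFeasible A)
    (hd : direction A b t p = 0) (hq : IsDualSolution A b t q) : q = p := by
  obtain ⟨x, hx⟩ := exists_descentCertificate b ht.le hp
  have hle := hq p
  have hqmem : q ∈ dualFeasible A := mem_dualFeasible_of_potential_lt_top
    (hle.trans_lt (by rw [potential_of_mem b t hp]; exact EReal.coe_lt_top _))
  rw [potential_of_mem b t hp, potential_of_mem b t hqmem, EReal.coe_le_coe_iff] at hle
  have h1 := smoothPart_sub b t p q
  have h2 := neg_normOne_le_inner_applyMat hqmem x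
  have h3 := hx.eq
  rw [hd, zero_add] at h3
  rw [← h3, inner_sub_right] at h1
  have h4 : ‖q - p‖ ^ 2 ≤ 0 := by
    have : t / 2 * ‖q - p‖ ^ 2 ≤ 0 := by linarith [hx.normOne_eq]
    by_contra! hpos
    have := mul_pos (half_pos ht) hpos
    linarith
  exact sub_eq_zero.1 (norm_eq_zero.1 (pow_eq_zero_iff two_ne_zero |>.1
    (le_antisymm h4 (sq_nonneg _))))

/-- Weak duality turns a certificate with zero direction into a primal solution. -/
theorem isPrimalSolution_of_certificate (ht : 0 ≤ t) {p : Euc m} {x : Fin n → ℝ}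
    (hx : DescentCertificate A b t p x 0) : IsPrimalSolution A b t x := by
  have heq : applyMat A x = b + t • p := by rw [hx.eq, zero_add]
  have hweak : ∀ y, -inner ℝ (applyMat A y) p ≤ normOne y := fun y =>
    neg_le.1 (neg_normOne_le_inner_applyMat hx.mem y)
  unfold IsPrimalSolution
  split_ifs with h0
  · rw [h0, zero_smul, add_zero] at heq
    refine ⟨heq, fun y hy => ?_⟩
    rw [hx.normOne_eq, heq, ← hy]
    exact hweak y
  · intro y
    have htpos : 0 < t := lt_of_le_of_ne ht (Ne.symm h0)
    have hres : applyMat A x - b = t • p := by rw [heq, add_sub_cancel_left]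
    have hxval : normOne x + 1 / (2 * t) * ‖applyMat A x - b‖ ^ 2 =
        -inner ℝ b p - t / 2 * ‖p‖ ^ 2 := by
      rw [hres, hx.normOne_eq, heq, inner_add_left, real_inner_smul_left,
        real_inner_self_eq_norm_sq, norm_smul, mul_pow, Real.norm_eq_abs, sq_abs]
      field
    have hsq : 0 ≤ ‖(applyMat A y - b) - t • p‖ ^ 2 := sq_nonneg _
    rw [norm_sub_sq_real, real_inner_smul_right, inner_sub_left, norm_smul, mul_pow,
      Real.norm_eq_abs, sq_abs] at hsq
    -- Young's inequality `⟨A y - b, p⟩ ≤ ‖A y - b‖² / (2 t) + t ‖p‖² / 2`.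
    have hyoung : inner ℝ (applyMat A y) p - inner ℝ b p - t / 2 * ‖p‖ ^ 2 ≤
        1 / (2 * t) * ‖applyMat A y - b‖ ^ 2 := by
      rw [one_div, inv_mul_eq_div, le_div_iff₀ (by positivity)]
      linarith
    rw [hxval]
    linarith [hweak y]

/-! ### The profile -/

theorem profile_zero_left (t : ℝ) : profile 0 t = 0 := by
  simp [profile]

theorem mul_profile (τ t : ℝ) : t * profile τ t = 1 - Real.exp (-(t * τ)) := by
  unfold profile
  split_ifs with h
  · simp [h]
  · field_simp

theorem mul_profile_lt_one (τ t : ℝ) : t * profile τ t < 1 := by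
  rw [mul_profile]
  linarith [Real.exp_pos (-(t * τ))]

theorem hasDerivAt_profile (t τ : ℝ) :
    HasDerivAt (fun τ => profile τ t) (1 - t * profile τ t) τ := by
  rw [mul_profile, sub_sub_cancel]
  unfold profile
  split_ifs with h
  · simpa [h] using hasDerivAt_id' τ
  · have h1 : HasDerivAt (fun τ : ℝ => -(t * τ)) (-t) τ := by
      simpa using ((hasDerivAt_id' τ).const_mul t).fun_neg
    convert! (h1.exp.const_sub 1).div_const t using 1
    field_simp

theorem lipschitzOnWith_profile (ht : 0 ≤ t) :
    LipschitzOnWith 1 (fun τ => profile τ t) (Ici 0) := by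
  refine Convex.lipschitzOnWith_of_nnnorm_hasDerivWithin_le (convex_Ici 0)
    (fun τ _ => (hasDerivAt_profile t τ).hasDerivWithinAt) fun τ hτ => ?_
  rw [← NNReal.coe_le_coe, coe_nnnorm, NNReal.coe_one, mul_profile, sub_sub_cancel,
    Real.norm_of_nonneg (Real.exp_pos _).le, Real.exp_le_one_iff, neg_nonpos]
  exact mul_nonneg ht hτ

theorem monotone_profile (t : ℝ) : Monotone fun τ => profile τ t :=
  monotone_of_hasDerivAt_nonneg (hasDerivAt_profile t) fun τ => by
    rw [Pi.zero_apply]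
    linarith [mul_profile_lt_one τ t]

theorem profile_nonneg {τ : ℝ} (hτ : 0 ≤ τ) (t : ℝ) : 0 ≤ profile τ t := by
  simpa only [profile_zero_left] using monotone_profile t hτ

theorem exists_profile_eq (ht : 0 ≤ t) {s : ℝ} (hs : 0 ≤ s) (hts : t * s < 1) :
    ∃ τ, 0 ≤ τ ∧ profile τ t = s := by
  rcases ht.eq_or_lt with rfl | ht
  · exact ⟨s, hs, by simp [profile]⟩
  · refine ⟨-Real.log (1 - t * s) / t, div_nonneg ?_ ht.le, ?_⟩
    · rw [neg_nonneg]
      exact Real.log_nonpos (by linarith) (by linarith [mul_nonneg ht.le hs])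
    · rw [profile, if_neg ht.ne', mul_div_cancel₀ _ ht.ne', neg_neg, Real.exp_log (by linarith),
        sub_sub_cancel, mul_div_cancel_left₀ _ ht.ne']

/-- The profile tends to `1 / t` (to `∞` if `t = 0`), so truncating it at an admissible level `s`
gives a function with limit `s`. -/
theorem tendsto_min_profile (ht : 0 ≤ t) {s : ℝ} (hts : t * s ≤ 1) :
    Tendsto (fun τ => min (profile τ t) s) atTop (𝓝 s) := by
  rcases ht.eq_or_lt with rfl | ht
  · refine tendsto_const_nhds.congr' ?_
    filter_upwards [eventually_ge_atTop s] with τ hτ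
    simp [profile, hτ]
  · have h1 : Tendsto (fun τ => profile τ t) atTop (𝓝 (1 / t)) := by
      have h2 : Tendsto (fun τ => Real.exp (-(t * τ))) atTop (𝓝 0) :=
        Real.tendsto_exp_neg_atTop_nhds_zero.comp (tendsto_id.const_mul_atTop ht)
      have h3 := (h2.const_sub 1).div_const t
      rw [sub_zero] at h3
      refine h3.congr fun τ => ?_
      rw [profile, if_neg ht.ne']
    have h4 := h1.min (tendsto_const_nhds (x := s))
    rwa [min_eq_right ((le_div_iff₀ ht).2 (by linarith))] at h4

/-! ### Steps between breakpoints -/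

/-- The length of the segment, in units of the direction, between the breakpoint `p` and the next
one. If `t = 0` and the step length is infinite, then the direction is zero and the value `0` is
chosen. -/
noncomputable def stepSize (A : Matrix (Fin m) (Fin n) ℝ) (b : Euc m) (t : ℝ) (p : Euc m) : ℝ :=
  if 0 < t then (min (stepLength A b t p) ((1 / t : ℝ) : EReal)).toReal
  else if stepLength A b t p < ⊤ then (stepLength A b t p).toReal else 0

theorem breakPoint_succ (A : Matrix (Fin m) (Fin n) ℝ) (b : Euc m) (t : ℝ) (p₀ : Euc m) (k : ℕ) :
    breakPoint A b t p₀ (k + 1) = breakPoint A b t p₀ k +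
      stepSize A b t (breakPoint A b t p₀ k) • direction A b t (breakPoint A b t p₀ k) := by
  rw [breakPoint, stepSize]
  split_ifs
  · rfl
  · rfl
  · rw [zero_smul]

theorem stepLength_cases (b : Euc m) (ht : 0 ≤ t) {p : Euc m} (hp : p ∈ dualFeasible A) :
    stepLength A b t p = ⊤ ∨ ∃ r : ℝ, 0 < r ∧ stepLength A b t p = r := by
  obtain ⟨x, hx⟩ := exists_descentCertificate b ht hp
  obtain ⟨ε, hε, hmem⟩ := hx.feasible
  have hle := (coe_le_maxDescentTime_iff hp hε.le).2 hmem
  change (ε : EReal) ≤ stepLength A b t p at hle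
  generalize stepLength A b t p = Δ at hle ⊢
  induction Δ with
  | bot => exact absurd hle (by simp)
  | top => exact Or.inl rfl
  | coe r => exact Or.inr ⟨r, hε.trans_le (EReal.coe_le_coe_iff.1 hle), rfl⟩

theorem stepLength_eq_top {p : Euc m} (hd : direction A b t p = 0) :
    stepLength A b t p = ⊤ := by
  rw [stepLength, hd, maxDescentTime_zero_right]

theorem stepLength_ne_top (hA : A.rank = m) {p : Euc m} (hd : direction A b t p ≠ 0) :
    stepLength A b t p ≠ ⊤ := (maxDescentTime_lt_top hA hd p).ne

theorem coe_mul_top {t : ℝ} (ht : 0 < t) : (t : EReal) * ⊤ = ⊤ := EReal.coe_mul_top_of_pos ht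

theorem not_mul_top_lt_one {t : ℝ} (ht : 0 < t) : ¬ (t : EReal) * ⊤ < 1 := by
  rw [coe_mul_top ht]
  simp

theorem pieceDuration_of_stepLength_eq_top (ht : 0 ≤ t) {p : Euc m}
    (h : stepLength A b t p = ⊤) : pieceDuration A b t p = ⊤ := by
  unfold pieceDuration
  rw [h]
  split_ifs with h0 h1
  · rfl
  · exact absurd h1 (not_mul_top_lt_one (lt_of_le_of_ne ht (Ne.symm h0)))
  · rfl

theorem pieceDuration_eq_top (ht : 0 ≤ t) {p : Euc m} (hd : direction A b t p = 0) :
    pieceDuration A b t p = ⊤ :=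
  pieceDuration_of_stepLength_eq_top ht (stepLength_eq_top hd)

/-- A step with nonzero direction either reaches the minimiser `p + d / t` of the quadratic, or ends
where the ray leaves the dual polytope. -/
theorem stepSize_eq_or (hA : A.rank = m) (ht : 0 ≤ t) {p : Euc m} (hp : p ∈ dualFeasible A)
    (hd : direction A b t p ≠ 0) :
    (0 < t ∧ stepSize A b t p = 1 / t ∧ ((1 / t : ℝ) : EReal) ≤ stepLength A b t p) ∨
      (0 < stepSize A b t p ∧ t * stepSize A b t p < 1 ∧
        stepLength A b t p = stepSize A b t p) := by
  obtain ⟨r, hr, hstep⟩ := (stepLength_cases b ht hp).resolve_left (stepLength_ne_top hA hd)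
  rcases ht.eq_or_lt with rfl | ht
  · right
    have : stepSize A b 0 p = r := by simp [stepSize, hstep]
    simp [this, hr, hstep]
  · have hmin : stepSize A b t p = min r (1 / t) := by
      rw [stepSize, if_pos ht, hstep, ← EReal.coe_strictMono.monotone.map_min, EReal.toReal_coe]
    rw [hmin, hstep]
    rcases le_or_gt (1 / t) r with h | h
    · exact Or.inl ⟨ht, min_eq_right h, EReal.coe_le_coe_iff.2 h⟩
    · right
      rw [min_eq_left h.le]
      refine ⟨hr, ?_, rfl⟩
      rw [lt_div_iff₀ ht] at h
      linarith

theorem mul_stepSize_le_one (hA : A.rank = m) (ht : 0 ≤ t) {p : Euc m} (hp : p ∈ dualFeasible A)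
    (hd : direction A b t p ≠ 0) : t * stepSize A b t p ≤ 1 := by
  rcases stepSize_eq_or hA ht hp hd with ⟨h0, h, -⟩ | ⟨-, h, -⟩
  · rw [h, mul_one_div_cancel h0.ne']
  · exact h.le

theorem stepSize_pos (hA : A.rank = m) (ht : 0 ≤ t) {p : Euc m} (hp : p ∈ dualFeasible A)
    (hd : direction A b t p ≠ 0) : 0 < stepSize A b t p := by
  rcases stepSize_eq_or hA ht hp hd with ⟨h0, h, -⟩ | ⟨h, -⟩
  · rw [h]
    positivity
  · exact h

theorem add_stepSize_smul_mem (hA : A.rank = m) (ht : 0 ≤ t) {p : Euc m}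
    (hp : p ∈ dualFeasible A) :
    p + stepSize A b t p • direction A b t p ∈ dualFeasible A := by
  by_cases hd : direction A b t p = 0
  · simpa [hd] using hp
  · refine (coe_le_maxDescentTime_iff hp (stepSize_pos hA ht hp hd).le).1 ?_
    change _ ≤ stepLength A b t p
    rcases stepSize_eq_or hA ht hp hd with ⟨-, h, hle⟩ | ⟨-, -, h⟩
    · rwa [h]
    · exact h.ge

theorem add_smul_notMem_of_stepSize_lt {p : Euc m} (hp : p ∈ dualFeasible A)
    (hpos : 0 ≤ stepSize A b t p) (h : stepLength A b t p = stepSize A b t p) {r : ℝ}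
    (hr : stepSize A b t p < r) : p + r • direction A b t p ∉ dualFeasible A := by
  intro hmem
  have := (coe_le_maxDescentTime_iff hp (hpos.trans hr.le)).2 hmem
  change _ ≤ stepLength A b t p at this
  rw [h, EReal.coe_le_coe_iff] at this
  linarith

/-- The steepest descent direction along a segment between breakpoints. -/
theorem direction_add_smul (hA : A.rank = m) (ht : 0 ≤ t) {p : Euc m} (hp : p ∈ dualFeasible A)
    {s : ℝ} (hs : 0 ≤ s) (hlt : direction A b t p ≠ 0 → s < stepSize A b t p) :
    direction A b t (p + s • direction A b t p) = (1 - t * s) • direction A b t p := by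
  by_cases hd : direction A b t p = 0
  · simp [hd]
  · obtain ⟨x, hx⟩ := exists_descentCertificate b ht hp
    have hts : t * s ≤ 1 := (mul_le_mul_of_nonneg_left (hlt hd).le ht).trans
      (mul_stepSize_le_one hA ht hp hd)
    exact (hx.along_ray hs (Or.inl ⟨hlt hd, hts⟩) (add_stepSize_smul_mem hA ht hp)).direction_eq ht

/-- A step reaching the minimiser `p + d / t` of the quadratic ends at a certified optimum. -/
theorem certificate_of_full_step (ht : 0 < t) {p d : Euc m} {x : Fin n → ℝ}
    (hx : DescentCertificate A b t p x d) (hmem : p + (1 / t) • d ∈ dualFeasible A) :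
    DescentCertificate A b t (p + (1 / t) • d) x 0 := by
  have h1 : t * (1 / t) = 1 := mul_one_div_cancel ht.ne'
  simpa [h1, -one_div] using hx.along_ray (by positivity) (Or.inr ⟨rfl, h1⟩) hmem

/-- In terms of the profile, the duration of a piece is the time at which the profile reaches the
length of the step; for a step of length `1 / t` this never happens. -/
theorem coe_lt_pieceDuration_iff (hA : A.rank = m) (ht : 0 ≤ t) {p : Euc m}
    (hp : p ∈ dualFeasible A) (hd : direction A b t p ≠ 0) {τ : ℝ} :
    (τ : EReal) < pieceDuration A b t p ↔ profile τ t < stepSize A b t p := by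
  rcases stepSize_eq_or hA ht hp hd with ⟨h0, h, hle⟩ | ⟨hpos, hts, h⟩
  · have h1 : ¬ (t : EReal) * stepLength A b t p < 1 := by
      rw [not_lt]
      calc (1 : EReal) = ((t * (1 / t) : ℝ) : EReal) := by
            rw [mul_one_div_cancel h0.ne', EReal.coe_one]
        _ = (t : EReal) * ((1 / t : ℝ) : EReal) := EReal.coe_mul _ _
        _ ≤ _ := mul_le_mul_of_nonneg_left hle (by exact_mod_cast h0.le)
    rw [pieceDuration, if_neg h0.ne', if_neg h1, h, lt_div_iff₀ h0, mul_comm]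
    exact iff_of_true (EReal.coe_lt_top _) (mul_profile_lt_one τ t)
  · rw [pieceDuration]
    split_ifs with h0 h1
    · rw [h, EReal.coe_lt_coe_iff, profile, if_pos h0]
    · have h0' : 0 < t := lt_of_le_of_ne ht (Ne.symm h0)
      rw [EReal.coe_lt_coe_iff, h, EReal.toReal_coe, profile, if_neg h0, lt_div_iff₀ h0',
        div_lt_iff₀ h0', lt_neg, Real.log_lt_iff_lt_exp (by linarith), sub_lt_comm,
        mul_comm τ, mul_comm t (stepSize A b t p)]
    · exact absurd (by rw [h]; exact_mod_cast hts) h1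

theorem pieceDuration_pos (hA : A.rank = m) (ht : 0 ≤ t) {p : Euc m} (hp : p ∈ dualFeasible A) :
    0 < pieceDuration A b t p := by
  by_cases hd : direction A b t p = 0
  · rw [pieceDuration_eq_top ht hd]
    exact EReal.zero_lt_top
  · have := (coe_lt_pieceDuration_iff (τ := 0) hA ht hp hd).2
      (by rw [profile_zero_left]; exact stepSize_pos hA ht hp hd)
    simpa using this

theorem pieceDuration_lt_top (hA : A.rank = m) (ht : 0 ≤ t) {p : Euc m} (hp : p ∈ dualFeasible A)
    (hd : direction A b t p ≠ 0) (hts : t * stepSize A b t p < 1) :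
    pieceDuration A b t p < ⊤ := by
  obtain ⟨τ, -, hτ⟩ := exists_profile_eq ht (stepSize_pos hA ht hp hd).le hts
  have := mt (coe_lt_pieceDuration_iff hA ht hp hd).1 hτ.not_lt
  exact (not_lt.1 this).trans_lt (EReal.coe_lt_top _)

/-! ### Breakpoints and their times -/

variable {p₀ : Euc m}

theorem breakPoint_mem (hA : A.rank = m) (ht : 0 ≤ t) (hp₀ : p₀ ∈ dualFeasible A) (k : ℕ) :
    breakPoint A b t p₀ k ∈ dualFeasible A := by
  induction k with
  | zero => exact hp₀
  | succ k ih =>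
    rw [breakPoint_succ]
    exact add_stepSize_smul_mem hA ht ih

theorem breakPoint_eq_add_sum (A : Matrix (Fin m) (Fin n) ℝ) (b : Euc m) (t : ℝ) (p₀ : Euc m)
    (k : ℕ) : breakPoint A b t p₀ k = p₀ + ∑ i ∈ Finset.range k,
      stepSize A b t (breakPoint A b t p₀ i) • direction A b t (breakPoint A b t p₀ i) := by
  induction k with
  | zero => simp [breakPoint]
  | succ k ih => rw [breakPoint_succ, Finset.sum_range_succ, ← add_assoc, ← ih]

theorem breakPoint_eq_of_direction_eq_zero {K : ℕ}
    (hK : direction A b t (breakPoint A b t p₀ K) = 0) {k : ℕ} (hk : K ≤ k) :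
    breakPoint A b t p₀ k = breakPoint A b t p₀ K := by
  induction k, hk using Nat.le_induction with
  | base => rfl
  | succ k _ ih => rw [breakPoint_succ, ih, hK, smul_zero, add_zero]

theorem direction_full_step_eq_zero (ht : 0 < t)
    {p : Euc m} (hp : p ∈ dualFeasible A)
    (hle : ((1 / t : ℝ) : EReal) ≤ maxDescentTime A p (direction A b t p)) :
    direction A b t (p + (1 / t) • direction A b t p) = 0 := by
  obtain ⟨x, hx⟩ := exists_descentCertificate b ht.le hp
  exact (certificate_of_full_step ht hx
    ((coe_le_maxDescentTime_iff hp (by positivity)).1 hle)).direction_eq ht.le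

/-- The direction vanishes after finitely many steps: otherwise `‖A x‖` would strictly increase from
breakpoint to breakpoint, while it takes at most one value for each of the finitely many signed
active sets. -/
theorem exists_direction_breakPoint_eq_zero (hA : A.rank = m) (ht : 0 ≤ t)
    (hp₀ : p₀ ∈ dualFeasible A) : ∃ K, direction A b t (breakPoint A b t p₀ K) = 0 := by
  by_contra! hne
  have hmem := breakPoint_mem (b := b) hA ht hp₀
  choose x hx using fun k => exists_descentCertificate b ht (hmem k)
  have hmono : StrictMono fun k => ‖applyMat A (x k)‖ ^ 2 := by
    refine strictMono_nat_of_lt_succ fun k => ?_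
    rcases stepSize_eq_or hA ht (hmem k) (hne k) with ⟨h0, h, hle⟩ | ⟨hpos, hts, h⟩
    · have := direction_full_step_eq_zero h0 (hmem k) hle
      rw [← h, ← breakPoint_succ] at this
      exact absurd this (hne _)
    · have hnext := hx (k + 1)
      rw [breakPoint_succ] at hnext
      exact (hx k).norm_lt_of_breakpoint hts hnext fun r hr =>
        add_smul_notMem_of_stepSize_lt (hmem k) hpos.le h hr
  obtain ⟨i, j, hij, hpat⟩ :=
    Finite.exists_ne_map_eq_of_infinite fun k => activePattern A (breakPoint A b t p₀ k)
  refine hij (hmono.injective ?_)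
  rw [(hx i).applyMat_eq_of_activePattern_eq (hx j) hpat]

theorem breakTime_le_succ (hA : A.rank = m) (ht : 0 ≤ t) (hp₀ : p₀ ∈ dualFeasible A) (k : ℕ) :
    breakTime A b t p₀ k ≤ breakTime A b t p₀ (k + 1) :=
  le_add_of_nonneg_right (pieceDuration_pos hA ht (breakPoint_mem hA ht hp₀ k)).le

theorem monotone_breakTime (hA : A.rank = m) (ht : 0 ≤ t) (hp₀ : p₀ ∈ dualFeasible A) :
    Monotone (breakTime A b t p₀) :=
  monotone_nat_of_le_succ (breakTime_le_succ hA ht hp₀)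

theorem breakTime_nonneg (hA : A.rank = m) (ht : 0 ≤ t) (hp₀ : p₀ ∈ dualFeasible A) (k : ℕ) :
    0 ≤ breakTime A b t p₀ k :=
  monotone_breakTime hA ht hp₀ (Nat.zero_le k)

theorem coe_toReal_breakTime (hA : A.rank = m) (ht : 0 ≤ t) (hp₀ : p₀ ∈ dualFeasible A) {k : ℕ}
    (h : breakTime A b t p₀ k < ⊤) :
    ((breakTime A b t p₀ k).toReal : EReal) = breakTime A b t p₀ k :=
  EReal.coe_toReal h.ne (((EReal.bot_lt_zero).trans_le (breakTime_nonneg hA ht hp₀ k)).ne')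

theorem breakTime_succ_eq_top (hA : A.rank = m) (ht : 0 ≤ t) (hp₀ : p₀ ∈ dualFeasible A) {k : ℕ}
    (hk : direction A b t (breakPoint A b t p₀ k) = 0) : breakTime A b t p₀ (k + 1) = ⊤ := by
  rw [breakTime, pieceDuration_eq_top ht hk]
  exact EReal.add_top_of_ne_bot
    (((EReal.bot_lt_zero).trans_le (breakTime_nonneg hA ht hp₀ k)).ne')

theorem breakTime_lt_top (hA : A.rank = m) (ht : 0 ≤ t) (hp₀ : p₀ ∈ dualFeasible A) {k : ℕ}
    (hk : ∀ i < k, direction A b t (breakPoint A b t p₀ i) ≠ 0 ∧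
      t * stepSize A b t (breakPoint A b t p₀ i) < 1) : breakTime A b t p₀ k < ⊤ := by
  induction k with
  | zero => exact EReal.zero_lt_top
  | succ k ih =>
    have h := hk k (Nat.lt_succ_self k)
    exact EReal.add_lt_top (ih fun i hi => hk i (hi.trans (Nat.lt_succ_self k))).ne
      (pieceDuration_lt_top hA ht (breakPoint_mem hA ht hp₀ k) h.1 h.2).ne

/-- Only the step into the last breakpoint can take infinite time. -/
theorem breakTime_lt_top_of_direction_ne_zero (hA : A.rank = m) (ht : 0 ≤ t)
    (hp₀ : p₀ ∈ dualFeasible A) {K : ℕ}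
    (hK : ∀ k < K, direction A b t (breakPoint A b t p₀ k) ≠ 0) {k : ℕ} (hk : k < K) :
    breakTime A b t p₀ k < ⊤ := by
  refine breakTime_lt_top hA ht hp₀ fun i hi => ⟨hK i (hi.trans hk), ?_⟩
  have hmem := breakPoint_mem (b := b) hA ht hp₀ i
  rcases stepSize_eq_or hA ht hmem (hK i (hi.trans hk)) with ⟨h0, h, hle⟩ | ⟨-, hts, -⟩
  · have := direction_full_step_eq_zero h0 hmem hle
    rw [← h, ← breakPoint_succ] at this
    exact absurd this (hK _ (by omega))
  · exact hts

theorem coe_lt_coe_add_iff {τ T : ℝ} {δ : EReal} (hδ : 0 < δ) :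
    (τ : EReal) < T + δ ↔ ((τ - T : ℝ) : EReal) < δ := by
  induction δ with
  | bot => exact absurd hδ (by simp)
  | top =>
    rw [EReal.coe_add_top]
    exact iff_of_true (EReal.coe_lt_top _) (EReal.coe_lt_top _)
  | coe r => rw [← EReal.coe_add, EReal.coe_lt_coe_iff, EReal.coe_lt_coe_iff, sub_lt_iff_lt_add']

/-- Every time lies in a piece `[τ⁽ᵏ⁾, τ⁽ᵏ⁺¹⁾)`. -/
theorem exists_breakTime_le_lt (hA : A.rank = m) (ht : 0 ≤ t) (hp₀ : p₀ ∈ dualFeasible A) {τ : ℝ}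
    (hτ : 0 ≤ τ) : ∃ k, breakTime A b t p₀ k ≤ τ ∧ (τ : EReal) < breakTime A b t p₀ (k + 1) := by
  classical
  obtain ⟨K, hK⟩ := exists_direction_breakPoint_eq_zero (b := b) hA ht hp₀
  have hex : ∃ k, (τ : EReal) < breakTime A b t p₀ (k + 1) :=
    ⟨K, by rw [breakTime_succ_eq_top hA ht hp₀ hK]; exact EReal.coe_lt_top _⟩
  refine ⟨Nat.find hex, ?_, Nat.find_spec hex⟩
  rcases h : Nat.find hex with _ | k
  · simpa [breakTime] using hτ
  · exact not_lt.1 (Nat.find_min hex (by omega : k < Nat.find hex))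

/-! ### Existence of the slow solution -/

/-- The slow solution in closed form: the contribution of the `k`-th piece starts at the `k`-th
break time and is frozen once it has reached the length of the `k`-th step. Only the finitely many
pieces with nonzero direction are summed. -/
noncomputable def slowPath (A : Matrix (Fin m) (Fin n) ℝ) (b : Euc m) (t : ℝ) (p₀ : Euc m) (K : ℕ)
    (τ : ℝ) : Euc m :=
  p₀ + ∑ k ∈ Finset.range K,
    min (profile (max 0 (τ - (breakTime A b t p₀ k).toReal)) t)
      (stepSize A b t (breakPoint A b t p₀ k)) • direction A b t (breakPoint A b t p₀ k)

theorem exists_lipschitzWith_slowPath (A : Matrix (Fin m) (Fin n) ℝ) (b : Euc m) (ht : 0 ≤ t)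
    (p₀ : Euc m) (K : ℕ) : ∃ L, LipschitzWith L (slowPath A b t p₀ K) := by
  have hterm : ∀ (T S : ℝ) (d : Euc m), ∃ L,
      LipschitzWith L fun τ : ℝ => min (profile (max 0 (τ - T)) t) S • d := by
    intro T S d
    have h1 : LipschitzWith 1 fun τ : ℝ => max 0 (τ - T) :=
      LipschitzWith.const_max (by simpa using LipschitzWith.id.sub (LipschitzWith.const T)) 0
    have h2 : LipschitzWith (1 * 1) fun τ : ℝ => profile (max 0 (τ - T)) t :=
      lipschitzOnWith_univ.1 <| (lipschitzOnWith_profile ht).comp (lipschitzOnWith_univ.2 h1)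
        fun τ _ => mem_Ici.2 (le_max_left _ _)
    exact ⟨_, (ContinuousLinearMap.toSpanSingleton ℝ d).lipschitz.comp (h2.min_const S)⟩
  induction K with
  | zero => exact ⟨0, by simp [slowPath]⟩
  | succ K ih =>
    obtain ⟨L, hL⟩ := ih
    obtain ⟨L', hL'⟩ := hterm (breakTime A b t p₀ K).toReal
      (stepSize A b t (breakPoint A b t p₀ K)) (direction A b t (breakPoint A b t p₀ K))
    refine ⟨L + L', ?_⟩
    convert! hL.add hL' using 1
    ext1 τ
    simp only [slowPath, Finset.sum_range_succ, add_assoc]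

theorem slowPath_eq (hA : A.rank = m) (ht : 0 ≤ t) (hp₀ : p₀ ∈ dualFeasible A) {K : ℕ}
    (hK : direction A b t (breakPoint A b t p₀ K) = 0)
    (hlt : ∀ k < K, direction A b t (breakPoint A b t p₀ k) ≠ 0) {k : ℕ} {τ : ℝ}
    (h1 : breakTime A b t p₀ k ≤ τ) (h2 : (τ : EReal) < breakTime A b t p₀ (k + 1)) :
    slowPath A b t p₀ K τ = breakPoint A b t p₀ k +
      profile (τ - (breakTime A b t p₀ k).toReal) t •
        direction A b t (breakPoint A b t p₀ k) := by
  have hmono := monotone_breakTime (b := b) hA ht hp₀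
  have hmem := breakPoint_mem (b := b) hA ht hp₀
  have hT : ∀ i ≤ k, ((breakTime A b t p₀ i).toReal : EReal) = breakTime A b t p₀ i := fun i hi =>
    coe_toReal_breakTime hA ht hp₀ (((hmono hi).trans h1).trans_lt (EReal.coe_lt_top _))
  have hTle : ∀ i ≤ k, (breakTime A b t p₀ i).toReal ≤ τ := fun i hi => by
    rw [← EReal.coe_le_coe_iff, hT i hi]
    exact (hmono hi).trans h1
  set g : ℕ → Euc m := fun i => min (profile (max 0 (τ - (breakTime A b t p₀ i).toReal)) t)
      (stepSize A b t (breakPoint A b t p₀ i)) • direction A b t (breakPoint A b t p₀ i) with hg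
  -- Past the index `K` all directions are zero.
  have hpast : ∀ i, K ≤ i → g i = 0 := fun i hi => by
    simp only [hg]
    rw [breakPoint_eq_of_direction_eq_zero hK hi, hK, smul_zero]
  -- The pieces after the `k`-th one have not started at time `τ`.
  have hfuture : ∀ i, k < i → g i = 0 := fun i hi => by
    rcases le_or_gt K i with hKi | hiK
    · exact hpast i hKi
    · have hTi := coe_toReal_breakTime hA ht hp₀
        (breakTime_lt_top_of_direction_ne_zero hA ht hp₀ hlt hiK)
      have : τ < (breakTime A b t p₀ i).toReal := by
        rw [← EReal.coe_lt_coe_iff, hTi]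
        exact h2.trans_le (hmono hi)
      simp only [hg]
      rw [max_eq_left (by linarith), profile_zero_left,
        min_eq_left (stepSize_pos hA ht (hmem i) (hlt i hiK)).le, zero_smul]
  have hsum : ∑ i ∈ Finset.range K, g i = ∑ i ∈ Finset.range (k + 1), g i := by
    rcases le_total K (k + 1) with h | h
    · refine Finset.sum_subset (Finset.range_mono h) fun i _ hi => hpast i ?_
      simpa using hi
    · refine (Finset.sum_subset (Finset.range_mono h) fun i _ hi => hfuture i ?_).symm
      simpa using hi
  -- The pieces before the `k`-th one have reached their full length at time `τ`.
  have hdone : ∀ i ∈ Finset.range k, g i =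
      stepSize A b t (breakPoint A b t p₀ i) • direction A b t (breakPoint A b t p₀ i) := by
    intro i hi
    have hik : i < k := Finset.mem_range.1 hi
    by_cases hd : direction A b t (breakPoint A b t p₀ i) = 0
    · simp [hg, hd]
    · have h3 : ¬ (τ : EReal) < breakTime A b t p₀ (i + 1) := not_lt.2 ((hmono hik).trans h1)
      rw [breakTime, ← hT i hik.le, coe_lt_coe_add_iff (pieceDuration_pos hA ht (hmem i)),
        coe_lt_pieceDuration_iff hA ht (hmem i) hd, not_lt] at h3
      simp only [hg]
      rw [max_eq_right (sub_nonneg.2 (hTle i hik.le)), min_eq_right h3]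
  have hnow : g k = profile (τ - (breakTime A b t p₀ k).toReal) t •
      direction A b t (breakPoint A b t p₀ k) := by
    by_cases hd : direction A b t (breakPoint A b t p₀ k) = 0
    · simp [hg, hd]
    · rw [breakTime, ← hT k le_rfl, coe_lt_coe_add_iff (pieceDuration_pos hA ht (hmem k)),
        coe_lt_pieceDuration_iff hA ht (hmem k) hd] at h2
      simp only [hg]
      rw [max_eq_right (sub_nonneg.2 (hTle k le_rfl)), min_eq_left h2.le]
  calc slowPath A b t p₀ K τ = p₀ + ∑ i ∈ Finset.range K, g i := rfl
    _ = _ := by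
      rw [hsum, Finset.sum_range_succ, Finset.sum_congr rfl hdone, hnow, ← add_assoc,
        ← breakPoint_eq_add_sum]

/-- Within a piece, the profile stays below the length of the step. -/
theorem profile_lt_stepSize (hA : A.rank = m) (ht : 0 ≤ t) (hp₀ : p₀ ∈ dualFeasible A) {k : ℕ}
    {τ : ℝ} (h1 : breakTime A b t p₀ k ≤ τ) (h2 : (τ : EReal) < breakTime A b t p₀ (k + 1))
    (hd : direction A b t (breakPoint A b t p₀ k) ≠ 0) :
    profile (τ - (breakTime A b t p₀ k).toReal) t < stepSize A b t (breakPoint A b t p₀ k) := by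
  have hmem := breakPoint_mem (b := b) hA ht hp₀ k
  rwa [breakTime, ← coe_toReal_breakTime hA ht hp₀ (h1.trans_lt (EReal.coe_lt_top _)),
    coe_lt_coe_add_iff (pieceDuration_pos hA ht hmem),
    coe_lt_pieceDuration_iff hA ht hmem hd] at h2

theorem toReal_breakTime_le (hA : A.rank = m) (ht : 0 ≤ t) (hp₀ : p₀ ∈ dualFeasible A) {k : ℕ}
    {τ : ℝ} (h1 : breakTime A b t p₀ k ≤ τ) : (breakTime A b t p₀ k).toReal ≤ τ := by
  rwa [← EReal.coe_le_coe_iff,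
    coe_toReal_breakTime hA ht hp₀ (h1.trans_lt (EReal.coe_lt_top _))]

theorem isSlowSolution_slowPath (hA : A.rank = m) (ht : 0 ≤ t) (hp₀ : p₀ ∈ dualFeasible A) {K : ℕ}
    (hK : direction A b t (breakPoint A b t p₀ K) = 0)
    (hlt : ∀ k < K, direction A b t (breakPoint A b t p₀ k) ≠ 0) :
    IsSlowSolution A b t p₀ (slowPath A b t p₀ K) := by
  have hmem := breakPoint_mem (b := b) hA ht hp₀
  have hpiece : ∀ (T τ : ℝ) (q d : Euc m), HasDerivAt (fun τ => q + profile (τ - T) t • d)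
      ((1 - t * profile (τ - T) t) • d) τ := fun T τ q d =>
    (((hasDerivAt_profile t (τ - T)).comp_sub_const τ T).smul_const d).const_add q
  have hpos : (0 : EReal) < breakTime A b t p₀ 1 := by
    simpa [breakTime] using pieceDuration_pos hA ht (hmem 0)
  have h0 : slowPath A b t p₀ K 0 = p₀ := by
    rw [slowPath_eq hA ht hp₀ hK hlt (k := 0) (by simp [breakTime]) (by simpa using hpos)]
    simp [breakTime, breakPoint, profile_zero_left]
  refine ⟨h0, fun τ hτ => ?_, fun T _ => ?_, ?_, ?_⟩
  · obtain ⟨k, h1, h2⟩ := exists_breakTime_le_lt (b := b) hA ht hp₀ hτ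
    rw [subdiffDomain_potential b ht, slowPath_eq hA ht hp₀ hK hlt h1 h2]
    by_cases hd : direction A b t (breakPoint A b t p₀ k) = 0
    · simpa [hd] using hmem k
    · exact add_smul_mem_dualFeasible_of_le (hmem k)
        (profile_nonneg (sub_nonneg.2 (toReal_breakTime_le hA ht hp₀ h1)) t)
        (profile_lt_stepSize hA ht hp₀ h1 h2 hd).le (add_stepSize_smul_mem hA ht (hmem k))
  · obtain ⟨L, hL⟩ := exists_lipschitzWith_slowPath A b ht p₀ K
    exact (hL.lipschitzOnWith (s := uIcc 0 T)).absolutelyContinuousOnInterval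
  · have hev : slowPath A b t p₀ K =ᶠ[𝓝[≥] 0]
        fun τ => p₀ + profile (τ - 0) t • direction A b t p₀ := by
      have hev' : ∀ᶠ τ : ℝ in 𝓝 0, (τ : EReal) < breakTime A b t p₀ 1 :=
        continuous_coe_real_ereal.continuousAt.eventually_lt_const (by simpa using hpos)
      filter_upwards [nhdsWithin_le_nhds hev', self_mem_nhdsWithin] with τ h2 h1
      rw [slowPath_eq hA ht hp₀ hK hlt (k := 0)
        (by simpa [breakTime] using EReal.coe_le_coe_iff.2 (mem_Ici.1 h1)) h2]
      simp [breakTime, breakPoint]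
    rw [h0]
    refine HasDerivWithinAt.congr_of_eventuallyEq ?_ hev (by simp [h0, profile_zero_left])
    simpa [profile_zero_left] using
      (hpiece 0 0 p₀ (direction A b t p₀)).hasDerivWithinAt (s := Ici 0)
  -- The equation holds off the countable set of break times.
  · have hbad := (countable_range fun k => (breakTime A b t p₀ k).toReal).ae_notMem volume
    filter_upwards [ae_restrict_of_ae hbad, ae_restrict_mem measurableSet_Ioi] with τ hτ hτ0
    obtain ⟨k, h1, h2⟩ := exists_breakTime_le_lt (b := b) hA ht hp₀ (le_of_lt (mem_Ioi.1 hτ0))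
    have hTk := coe_toReal_breakTime hA ht hp₀ (h1.trans_lt (EReal.coe_lt_top _))
    have h1' : (breakTime A b t p₀ k).toReal < τ :=
      lt_of_le_of_ne (toReal_breakTime_le hA ht hp₀ h1) fun h => hτ ⟨k, h⟩
    have hev : slowPath A b t p₀ K =ᶠ[𝓝 τ] fun τ => breakPoint A b t p₀ k +
        profile (τ - (breakTime A b t p₀ k).toReal) t •
          direction A b t (breakPoint A b t p₀ k) := by
      filter_upwards [Ioi_mem_nhds h1',
        continuous_coe_real_ereal.continuousAt.eventually_lt_const h2] with σ hσ1 hσ2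
      refine slowPath_eq hA ht hp₀ hK hlt ?_ hσ2
      rw [← hTk]
      exact EReal.coe_le_coe_iff.2 (le_of_lt hσ1)
    have hdir := direction_add_smul (b := b) hA ht (hmem k)
      (profile_nonneg (sub_nonneg.2 h1'.le) t) (profile_lt_stepSize hA ht hp₀ h1 h2)
    rw [slowPath_eq hA ht hp₀ hK hlt h1 h2, hdir]
    exact (hpiece _ τ _ _).congr_of_eventuallyEq hev

theorem tendsto_slowPath (hA : A.rank = m) (ht : 0 ≤ t) (hp₀ : p₀ ∈ dualFeasible A) {K : ℕ}
    (hlt : ∀ k < K, direction A b t (breakPoint A b t p₀ k) ≠ 0) :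
    Tendsto (slowPath A b t p₀ K) atTop (𝓝 (breakPoint A b t p₀ K)) := by
  rw [breakPoint_eq_add_sum]
  refine (tendsto_finsetSum _ fun k hk => Tendsto.smul_const ?_ _).const_add p₀
  have hmem := breakPoint_mem (b := b) hA ht hp₀ k
  refine (tendsto_min_profile ht
    (mul_stepSize_le_one hA ht hmem (hlt k (Finset.mem_range.1 hk)))).comp ?_
  exact tendsto_atTop_mono (fun τ => le_max_right _ _)
    (tendsto_atTop_add_const_right _ _ tendsto_id)

/-! ### Uniqueness of the slow solution -/

theorem inner_sub_direction_sub_nonpos (b : Euc m) (ht : 0 ≤ t) {p q : Euc m}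
    (hp : p ∈ dualFeasible A) (hq : q ∈ dualFeasible A) :
    inner ℝ (p - q) (direction A b t p - direction A b t q) ≤ 0 := by
  obtain ⟨x, hx⟩ := exists_descentCertificate b ht hp
  obtain ⟨y, hy⟩ := exists_descentCertificate b ht hq
  have h1 := (mem_subdifferential_potential.1 (hx.neg_mem_subdifferential ht)).2 q hq
  have h2 := (mem_subdifferential_potential.1 (hy.neg_mem_subdifferential ht)).2 p hp
  rw [← neg_sub p q, inner_neg_neg] at h1
  rw [inner_neg_left] at h2
  rw [inner_sub_right, real_inner_comm, real_inner_comm (direction A b t q)]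
  linarith

theorem _root_.AbsolutelyContinuousOnInterval.norm {F : Type*} [SeminormedAddCommGroup F]
    {f : ℝ → F} {a b : ℝ} (hf : AbsolutelyContinuousOnInterval f a b) :
    AbsolutelyContinuousOnInterval (fun x => ‖f x‖) a b := by
  refine squeeze_zero (fun E => Finset.sum_nonneg fun i _ => dist_nonneg) (fun E => ?_) hf
  exact Finset.sum_le_sum fun i _ =>
    (dist_norm_norm_le _ _).trans_eq (dist_eq_norm _ _).symm

/-- The subdifferential is monotone, so that the distance of two solutions does not increase. -/
theorem IsSlowSolution.eqOn (ht : 0 ≤ t) {p q : ℝ → Euc m} (hp : IsSlowSolution A b t p₀ p)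
    (hq : IsSlowSolution A b t p₀ q) : EqOn q p (Ici 0) := by
  intro T hT
  have hac : AbsolutelyContinuousOnInterval (fun τ => ‖p τ - q τ‖ * ‖p τ - q τ‖) 0 T := by
    have := ((hp.absolutelyContinuous T hT).fun_sub (hq.absolutelyContinuous T hT)).norm
    exact this.fun_mul this
  have hint := hac.fun_neg.integral_deriv_eq_sub
  have hnonneg : 0 ≤ ∫ τ in (0 : ℝ)..T, deriv (fun τ => -(‖p τ - q τ‖ * ‖p τ - q τ‖)) τ := by
    rw [intervalIntegral.integral_of_le hT]
    refine integral_nonneg_of_ae ?_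
    refine ae_mono (Measure.restrict_mono Ioc_subset_Ioi_self le_rfl) ?_
    filter_upwards [hp.deriv_ae, hq.deriv_ae, ae_restrict_mem measurableSet_Ioi] with τ h1 h2 h0
    have hd : HasDerivAt (fun τ => -(‖p τ - q τ‖ * ‖p τ - q τ‖))
        (-(2 * inner ℝ (p τ - q τ) (direction A b t (p τ) - direction A b t (q τ)))) τ := by
      simpa only [← sq] using (h1.fun_sub h2).norm_sq.fun_neg
    have hmem : ∀ {r : ℝ → Euc m}, IsSlowSolution A b t p₀ r → r τ ∈ dualFeasible A := fun hr => by
      rw [← subdiffDomain_potential b ht]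
      exact hr.mem_domain τ (le_of_lt h0)
    rw [hd.deriv, Pi.zero_apply]
    linarith [inner_sub_direction_sub_nonpos b ht (hmem hp) (hmem hq)]
  rw [hint, hp.init, hq.init, sub_self, norm_zero] at hnonneg
  have : ‖p T - q T‖ = 0 := by
    have := norm_nonneg (p T - q T)
    nlinarith
  exact (sub_eq_zero.1 (norm_eq_zero.1 this)).symm

/-! ### The active set algorithm -/

theorem one_le_coe_mul_iff (ht : 0 < t) {Δ : EReal} (hΔ : 0 ≤ Δ) :
    1 ≤ (t : EReal) * Δ ↔ ((1 / t : ℝ) : EReal) ≤ Δ := by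
  induction Δ with
  | bot => exact absurd hΔ (by simp)
  | top => simp [coe_mul_top ht]
  | coe r =>
    rw [← EReal.coe_mul, ← EReal.coe_one, EReal.coe_le_coe_iff, EReal.coe_le_coe_iff,
      div_le_iff₀ ht, mul_comm]

theorem algStops_iff (ht : 0 ≤ t) {p : Euc m} (hp : p ∈ dualFeasible A) {u : Fin n → ℝ}
    (hu : u ∈ nnlsSolutions A b t p) :
    AlgStops A b t p u ↔ (0 < t ∧ ((1 / t : ℝ) : EReal) ≤ stepLength A b t p) ∨
      (t = 0 ∧ direction A b t p = 0) := by
  rw [AlgStops, nnlsResidual_eq_direction ht hp hu]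
  refine or_congr (and_congr_right fun h => ?_) Iff.rfl
  exact one_le_coe_mul_iff h (maxDescentTime_nonneg hp _)

theorem algStops_of_direction_eq_zero (ht : 0 ≤ t) {p : Euc m} (hp : p ∈ dualFeasible A)
    {u : Fin n → ℝ} (hu : u ∈ nnlsSolutions A b t p) (hd : direction A b t p = 0) :
    AlgStops A b t p u := by
  rw [algStops_iff ht hp hu, stepLength_eq_top hd]
  rcases ht.eq_or_lt with h | h
  · exact Or.inr ⟨h.symm, hd⟩
  · exact Or.inl ⟨h, le_top⟩

/-- While it does not stop, the algorithm takes the same step as the slow solution. -/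
theorem toReal_stepLength_of_not_algStops (hA : A.rank = m) (ht : 0 ≤ t) {p : Euc m}
    (hp : p ∈ dualFeasible A) {u : Fin n → ℝ} (hu : u ∈ nnlsSolutions A b t p)
    (hhalt : ¬ AlgStops A b t p u) : (stepLength A b t p).toReal = stepSize A b t p := by
  have hd : direction A b t p ≠ 0 := fun h => hhalt (algStops_of_direction_eq_zero ht hp hu h)
  rw [algStops_iff ht hp hu] at hhalt
  rcases stepSize_eq_or hA ht hp hd with ⟨h0, -, hle⟩ | ⟨-, -, h⟩
  · exact absurd (Or.inl ⟨h0, hle⟩) hhalt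
  · rw [h, EReal.toReal_coe]

theorem exists_isAlgRun (A : Matrix (Fin m) (Fin n) ℝ) (b : Euc m) (t : ℝ) (p₀ : Euc m) :
    ∃ P U, IsAlgRun A b t p₀ P U := by
  choose u hu using fun p => nnlsSolutions_nonempty A b t p
  refine ⟨fun k => (fun p => p + (maxDescentTime A p (nnlsResidual A b t p (u p))).toReal •
    nnlsResidual A b t p (u p))^[k] p₀, _, rfl, fun k _ => hu _, fun k _ => ?_⟩
  rw [Function.iterate_succ_apply']

namespace IsAlgRun

variable {P : ℕ → Euc m} {U : ℕ → Fin n → ℝ}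

theorem eq_breakPoint (h : IsAlgRun A b t p₀ P U) (hA : A.rank = m) (ht : 0 ≤ t)
    (hp₀ : p₀ ∈ dualFeasible A) {k : ℕ} (hk : ∀ i < k, ¬ AlgStops A b t (P i) (U i)) :
    P k = breakPoint A b t p₀ k := by
  induction k with
  | zero => exact h.init
  | succ k ih =>
    have hk' : ∀ i < k, ¬ AlgStops A b t (P i) (U i) := fun i hi => hk i (by omega)
    have hP := ih hk'
    have hmem : P k ∈ dualFeasible A := hP ▸ breakPoint_mem hA ht hp₀ k
    have hu := h.nnls k hk'
    have hstep := toReal_stepLength_of_not_algStops hA ht hmem hu (hk k (by omega))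
    rw [h.update k fun i hi => hk i (by omega), nnlsResidual_eq_direction ht hmem hu,
      breakPoint_succ, ← hP, ← hstep]
    rfl

theorem exists_algStops (h : IsAlgRun A b t p₀ P U) (hA : A.rank = m) (ht : 0 ≤ t)
    (hp₀ : p₀ ∈ dualFeasible A) : ∃ N, AlgStops A b t (P N) (U N) := by
  by_contra! hne
  obtain ⟨K, hK⟩ := exists_direction_breakPoint_eq_zero (b := b) hA ht hp₀
  have hP := h.eq_breakPoint hA ht hp₀ (k := K) fun i _ => hne i
  exact hne K (algStops_of_direction_eq_zero ht (hP ▸ breakPoint_mem hA ht hp₀ K)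
    (h.nnls K fun i _ => hne i) (hP ▸ hK))

end IsAlgRun

theorem isPrimalSolution_of_direction_eq_zero (ht : 0 ≤ t) {p : Euc m} (hp : p ∈ dualFeasible A)
    (hd : direction A b t p = 0) {u : Fin n → ℝ} (hu : u ∈ nnlsSolutions A b t p) :
    IsPrimalSolution A b t (signMat A p *ᵥ u) := by
  refine isPrimalSolution_of_certificate (p := p) ht ?_
  rw [← hd, ← nnlsResidual_eq_direction ht hp hu]
  exact descentCertificate_of_mem_nnlsSolutions hp hu

/-- The output of the algorithm when it stops at a breakpoint. For `t > 0` it stops before the last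
step has been taken, and its dual output is the next breakpoint. -/
theorem algOutput_spec (hA : A.rank = m) (ht : 0 ≤ t) (hp₀ : p₀ ∈ dualFeasible A) {K N : ℕ}
    (hK : direction A b t (breakPoint A b t p₀ K) = 0)
    (hlt : ∀ k < K, direction A b t (breakPoint A b t p₀ k) ≠ 0) {u : Fin n → ℝ}
    (hu : u ∈ nnlsSolutions A b t (breakPoint A b t p₀ N))
    (hhalt : AlgStops A b t (breakPoint A b t p₀ N) u) :
    IsPrimalSolution A b t (algPrimal A (breakPoint A b t p₀ N) u) ∧
      algDual A b t (breakPoint A b t p₀ N) u = breakPoint A b t p₀ K := by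
  have hmem := breakPoint_mem (b := b) hA ht hp₀ N
  have hKle : ∀ k, direction A b t (breakPoint A b t p₀ k) = 0 → K ≤ k := fun k hk =>
    not_lt.1 fun h => hlt k h hk
  rw [algStops_iff ht hmem hu] at hhalt
  rw [algPrimal, algDual]
  rcases hhalt with ⟨h0, hle⟩ | ⟨h0, hd⟩
  · rw [if_pos h0]
    have hcert := certificate_of_full_step h0 (descentCertificate_of_mem_nnlsSolutions hmem hu)
    rw [nnlsResidual_eq_direction ht hmem hu] at hcert ⊢
    replace hcert := hcert ((coe_le_maxDescentTime_iff hmem (by positivity)).1 hle)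
    refine ⟨isPrimalSolution_of_certificate ht hcert, ?_⟩
    have hsucc : breakPoint A b t p₀ (N + 1) =
        breakPoint A b t p₀ N + (1 / t) • direction A b t (breakPoint A b t p₀ N) := by
      rw [breakPoint_succ, stepSize, if_pos h0, min_eq_right hle, EReal.toReal_coe]
    rw [← hsucc] at hcert ⊢
    exact breakPoint_eq_of_direction_eq_zero hK (hKle _ (hcert.direction_eq ht))
  · rw [if_neg h0.not_gt]
    exact ⟨isPrimalSolution_of_direction_eq_zero ht hmem hd hu,
      breakPoint_eq_of_direction_eq_zero hK (hKle N hd)⟩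

end BPDN

open BPDN
theorem mainTheorem1 {m n : ℕ} (A : Matrix (Fin m) (Fin n) ℝ) (hA : A.rank = m)
    (b : EuclideanSpace ℝ (Fin m)) (hb : b ≠ 0) (t : ℝ) (ht : 0 ≤ t)
    (p₀ : EuclideanSpace ℝ (Fin m)) (hp₀ : p₀ ∈ subdiffDomain (potential A b t)) :
    ∃ p : ℝ → EuclideanSpace ℝ (Fin m),
      -- the slow system has exactly one solution on `[0, ∞)`
      IsSlowSolution A b t p₀ p ∧
      (∀ q, IsSlowSolution A b t p₀ q → EqOn q p (Ici 0)) ∧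
      -- it is given piecewise by the explicit formula
      (∀ (k : ℕ) (τ : ℝ), breakTime A b t p₀ k ≤ (τ : EReal) →
        (τ : EReal) < breakTime A b t p₀ (k + 1) →
        p τ = breakPoint A b t p₀ k +
          profile (τ - (breakTime A b t p₀ k).toReal) t •
            direction A b t (breakPoint A b t p₀ k)) ∧
      -- the direction vanishes after finitely many pieces, and `p` stays there
      ∃ K : ℕ,
        direction A b t (breakPoint A b t p₀ K) = 0 ∧
        (∀ k < K, direction A b t (breakPoint A b t p₀ k) ≠ 0) ∧
        (∀ τ : ℝ, breakTime A b t p₀ K ≤ (τ : EReal) → p τ = breakPoint A b t p₀ K) ∧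
        (t = 0 → breakTime A b t p₀ K < ⊤) ∧
        Tendsto p atTop (𝓝 (breakPoint A b t p₀ K)) ∧
        -- the last point solves the dual problem
        IsDualSolution A b t (breakPoint A b t p₀ K) ∧
        (0 < t → ∀ q, IsDualSolution A b t q → q = breakPoint A b t p₀ K) ∧
        -- nonnegative least squares at the last point yields primal solutions
        (nnlsSolutions A b t (breakPoint A b t p₀ K)).Nonempty ∧
        (∀ u ∈ nnlsSolutions A b t (breakPoint A b t p₀ K),
          IsPrimalSolution A b t (signMat A (breakPoint A b t p₀ K) *ᵥ u)) ∧
        -- the active set algorithm can be run, always stops, and returns a correct pair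
        (∃ P U, IsAlgRun A b t p₀ P U) ∧
        (∀ P U, IsAlgRun A b t p₀ P U →
          ∃ N : ℕ, AlgStops A b t (P N) (U N) ∧
            (∀ i < N, ¬ AlgStops A b t (P i) (U i)) ∧
            IsPrimalSolution A b t (algPrimal A (P N) (U N)) ∧
            algDual A b t (P N) (U N) = breakPoint A b t p₀ K) := by
  classical
  rw [subdiffDomain_potential b ht] at hp₀
  have hex := exists_direction_breakPoint_eq_zero (b := b) hA ht hp₀
  have hK := Nat.find_spec hex
  have hlt : ∀ k < Nat.find hex, direction A b t (breakPoint A b t p₀ k) ≠ 0 :=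
    fun k hk => Nat.find_min hex hk
  set K := Nat.find hex
  have hmem := breakPoint_mem (b := b) hA ht hp₀
  have hsol := isSlowSolution_slowPath hA ht hp₀ hK hlt
  refine ⟨slowPath A b t p₀ K, hsol, fun q hq => hsol.eqOn ht hq,
    fun k τ h1 h2 => slowPath_eq hA ht hp₀ hK hlt h1 h2, K, hK, hlt, fun τ hτ => ?_, fun h0 => ?_,
    tendsto_slowPath hA ht hp₀ hlt, isDualSolution_of_direction_eq_zero ht (hmem K) hK,
    fun h0 q hq => eq_of_isDualSolution h0 (hmem K) hK hq, nnlsSolutions_nonempty A b t _,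
    fun u hu => isPrimalSolution_of_direction_eq_zero ht (hmem K) hK hu,
    exists_isAlgRun A b t p₀, fun P U hrun => ?_⟩
  · rw [slowPath_eq hA ht hp₀ hK hlt hτ
      (by rw [breakTime_succ_eq_top hA ht hp₀ hK]; exact EReal.coe_lt_top _), hK, smul_zero,
      add_zero]
  · exact breakTime_lt_top hA ht hp₀ fun i hi => ⟨hlt i hi, by simp [h0]⟩
  · have hhalt := hrun.exists_algStops hA ht hp₀
    have hrest : ∀ i < Nat.find hhalt, ¬ AlgStops A b t (P i) (U i) :=
      fun i hi => Nat.find_min hhalt hi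
    have hnnls := hrun.nnls _ hrest
    have hN := Nat.find_spec hhalt
    refine ⟨Nat.find hhalt, hN, hrest, ?_⟩
    rw [hrun.eq_breakPoint hA ht hp₀ hrest] at hnnls hN ⊢
    exact algOutput_spec hA ht hp₀ hK hlt hnnls hN
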